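/- Let $N \ge 1$ be an integer, let $p \in [2, +\infty)$ and $q \in [1, +\infty)$, and let $V : \mathbb{R}^N \to \mathbb{R}$ be an even measurable function such that $V^+ := \max(V, 0) \in L^q(\mathbb{R}^N)$ and $$\frac{1}{p}\Bigl(1 - \frac{1}{2q}\Bigr) \ge \frac{1}{2} - \frac{1}{N}.$$ For $\lambda \in [0, +\infty)$ let $V_\lambda(x) := \max\{V(x), -\lambda\}$ for $x \in \mathbb{R}^N$. Then, for every $\lambda \in [0, +\infty)$, the functional $\mathcal{J}_\lambda : H^1(\mathbb{R}^N) \to \mathbb{R}$ defined for real-valued $u \in H^1(\mathbb{R}^N)$ by $$\mathcal{J}_\lambda(u) = \int_{\mathbb{R}^N} \bigl(V_\lambda * |u|^p\bigr)\, |u|^p$$ is well defined, that is, for every $u \in H^1(\mathbb{R}^N)$ the integral defining $(V_\lambda * |u|^p)(x)$ converges absolutely for almost every $x \in \mathbb{R}^N$ and the function $(V_\lambda * |u|^p)|u|^p$ is integrable on $\mathbb{R}^N$; and $\mathcal{J}_\lambda$ is continuously differentiable on $H^1(\mathbb{R}^N)$. -/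

import Mathlib

open MeasureTheory
open scoped ContDiff

namespace Choquard

/-- The Euclidean space `ℝ^N`, with Lebesgue measure `volume`. -/
abbrev RN (N : ℕ) : Type := EuclideanSpace ℝ (Fin N)

/-- `g` is the weak (distributional) gradient of `u` on `ℝ^N`:
`∫ u ∂ᵢφ = - ∫ gᵢ φ` for every `φ ∈ C_c^∞(ℝ^N)` and every coordinate `i`. -/
def IsWeakGradient {N : ℕ} (u : RN N → ℝ) (g : RN N → RN N) : Prop :=
  ∀ φ : RN N → ℝ, ContDiff ℝ ∞ φ → HasCompactSupport φ → ∀ i : Fin N,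
    ∫ x, u x * fderiv ℝ φ x (EuclideanSpace.single i 1) = - ∫ x, g x i * φ x

theorem memLp_test {N : ℕ} {φ : RN N → ℝ} (hφ : ContDiff ℝ ∞ φ) (hc : HasCompactSupport φ) :
    MemLp φ 2 volume :=
  hφ.continuous.memLp_of_hasCompactSupport hc

theorem memLp_test_deriv {N : ℕ} {φ : RN N → ℝ} (hφ : ContDiff ℝ ∞ φ)
    (hc : HasCompactSupport φ) (v : RN N) :
    MemLp (fun x => fderiv ℝ φ x v) 2 volume :=
  ((hφ.continuous_fderiv (by simp)).clm_apply continuous_const).memLp_of_hasCompactSupport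
    (hc.fderiv_apply (𝕜 := ℝ) v)

theorem memLp_coord {N : ℕ} (g : Lp (RN N) 2 (volume : Measure (RN N))) (i : Fin N) :
    MemLp (fun x => g x i) 2 volume :=
  (EuclideanSpace.proj (𝕜 := ℝ) i : RN N →L[ℝ] ℝ).comp_memLp' (Lp.memLp g)

/-- The real Sobolev space `H¹(ℝ^N)`: the pairs `(u, ∇u)` with `u ∈ L²(ℝ^N)` real-valued whose weak
gradient `∇u` exists and is in `L²(ℝ^N)`. As the weak gradient is unique, the pair is determined by
`u`. The ambient Hilbert sum `WithLp 2` gives the norm `‖u‖² = ∫ |u|² + ∫ |∇u|²`. -/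
noncomputable def H1 (N : ℕ) :
    Submodule ℝ (WithLp 2 (Lp ℝ 2 (volume : Measure (RN N)) ×
      Lp (RN N) 2 (volume : Measure (RN N)))) where
  carrier := {z | IsWeakGradient (z.fst : RN N → ℝ) (z.snd : RN N → RN N)}
  zero_mem' := by
    intro φ hφ hc i
    have h1 : ∫ x, ((0 : Lp ℝ 2 (volume : Measure (RN N))) : RN N → ℝ) x *
        fderiv ℝ φ x (EuclideanSpace.single i 1) = 0 := by
      apply integral_eq_zero_of_ae
      filter_upwards [Lp.coeFn_zero ℝ 2 (volume : Measure (RN N))] with x hx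
      rw [hx]; simp
    have h2 : ∫ x, ((0 : Lp (RN N) 2 (volume : Measure (RN N))) : RN N → RN N) x i * φ x = 0 := by
      apply integral_eq_zero_of_ae
      filter_upwards [Lp.coeFn_zero (RN N) 2 (volume : Measure (RN N))] with x hx
      rw [hx]; simp
    change ∫ x, ((0 : Lp ℝ 2 (volume : Measure (RN N))) : RN N → ℝ) x *
        fderiv ℝ φ x (EuclideanSpace.single i 1) =
      - ∫ x, ((0 : Lp (RN N) 2 (volume : Measure (RN N))) : RN N → RN N) x i * φ x
    rw [h1, h2, neg_zero]
  add_mem' := by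
    intro a b ha hb φ hφ hc i
    have e1 : ∫ x, ((a.fst + b.fst : Lp ℝ 2 (volume : Measure (RN N))) : RN N → ℝ) x *
        fderiv ℝ φ x (EuclideanSpace.single i 1) =
        ∫ x, (a.fst x * fderiv ℝ φ x (EuclideanSpace.single i 1) +
          b.fst x * fderiv ℝ φ x (EuclideanSpace.single i 1)) := by
      apply integral_congr_ae
      filter_upwards [Lp.coeFn_add a.fst b.fst] with x hx
      rw [hx, Pi.add_apply, add_mul]
    have e2 : ∫ x, ((a.snd + b.snd : Lp (RN N) 2 (volume : Measure (RN N))) : RN N → RN N) x i *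
        φ x = ∫ x, (a.snd x i * φ x + b.snd x i * φ x) := by
      apply integral_congr_ae
      filter_upwards [Lp.coeFn_add a.snd b.snd] with x hx
      rw [hx, Pi.add_apply, PiLp.add_apply, add_mul]
    have d := memLp_test_deriv hφ hc (EuclideanSpace.single i 1)
    have t := memLp_test hφ hc
    have i1 : ∀ w : Lp ℝ 2 (volume : Measure (RN N)), Integrable (fun x => w x *
        fderiv ℝ φ x (EuclideanSpace.single i 1)) volume := fun w => (Lp.memLp w).integrable_mul d
    have i2 : ∀ w : Lp (RN N) 2 (volume : Measure (RN N)), Integrable (fun x => w x i * φ x)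
        volume := fun w => (memLp_coord w i).integrable_mul t
    rw [integral_add (i1 a.fst) (i1 b.fst)] at e1
    rw [integral_add (i2 a.snd) (i2 b.snd)] at e2
    have ea := ha φ hφ hc i
    have eb := hb φ hφ hc i
    change ∫ x, ((a.fst + b.fst : Lp ℝ 2 (volume : Measure (RN N))) : RN N → ℝ) x *
        fderiv ℝ φ x (EuclideanSpace.single i 1) =
      - ∫ x, ((a.snd + b.snd : Lp (RN N) 2 (volume : Measure (RN N))) : RN N → RN N) x i * φ x
    rw [e1, e2, ea, eb]
    ring
  smul_mem' := by
    intro c a ha φ hφ hc i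
    have e1 : ∫ x, ((c • a.fst : Lp ℝ 2 (volume : Measure (RN N))) : RN N → ℝ) x *
        fderiv ℝ φ x (EuclideanSpace.single i 1) =
        ∫ x, c * (a.fst x * fderiv ℝ φ x (EuclideanSpace.single i 1)) := by
      apply integral_congr_ae
      filter_upwards [Lp.coeFn_smul c a.fst] with x hx
      rw [hx, Pi.smul_apply, smul_eq_mul, mul_assoc]
    have e2 : ∫ x, ((c • a.snd : Lp (RN N) 2 (volume : Measure (RN N))) : RN N → RN N) x i *
        φ x = ∫ x, c * (a.snd x i * φ x) := by
      apply integral_congr_ae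
      filter_upwards [Lp.coeFn_smul c a.snd] with x hx
      rw [hx, Pi.smul_apply, PiLp.smul_apply, smul_eq_mul, mul_assoc]
    rw [integral_const_mul] at e1 e2
    have ea := ha φ hφ hc i
    change ∫ x, ((c • a.fst : Lp ℝ 2 (volume : Measure (RN N))) : RN N → ℝ) x *
        fderiv ℝ φ x (EuclideanSpace.single i 1) =
      - ∫ x, ((c • a.snd : Lp (RN N) 2 (volume : Measure (RN N))) : RN N → RN N) x i * φ x
    rw [e1, e2, ea]
    ring

/-- The function `|u|^p` on `ℝ^N` attached to `u ∈ H¹(ℝ^N)`. -/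
noncomputable def absPow {N : ℕ} (p : ℝ) (u : H1 N) : RN N → ℝ :=
  fun x => |u.1.fst x| ^ p

/-- The relaxed potential `V_lam = max (V, -lam)`. -/
def relaxedPotential {N : ℕ} (V : RN N → ℝ) (lam : ℝ) : RN N → ℝ :=
  fun x => max (V x) (-lam)

/-- The convolution `V_lam ∗ |u|^p`. -/
noncomputable def relaxedConv {N : ℕ} (p : ℝ) (V : RN N → ℝ) (lam : ℝ) (u : H1 N) : RN N → ℝ :=
  convolution (relaxedPotential V lam) (absPow p u) (ContinuousLinearMap.mul ℝ ℝ) volume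

/-- The relaxed functional `J_lam(u) = ∫ (V_lam ∗ |u|^p) |u|^p` on `H¹(ℝ^N)`. -/
noncomputable def relaxedFunctional {N : ℕ} (p : ℝ) (V : RN N → ℝ) (lam : ℝ) (u : H1 N) : ℝ :=
  ∫ x, relaxedConv p V lam u x * absPow p u x

end Choquard

/-! Choose s by 1/s = 1 - 1/(2q), so that 1/q + 2/s = 2. By Young's inequality, (f, g) ↦ ∫ (W ∗ f) g
is then a bounded bilinear form on L^s × L^s for W ∈ L^q. Write V_lam = V⁺ + W₂ with |W₂| ≤ lam: V⁺
is handled on L^s, and the bounded part W₂ on L¹. It remains to place |u|^p in L^s and in L¹, that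
is, u in L^(ps) and in L^p. Since 2 ≤ p ≤ ps, and since the hypothesis on p, q, N says exactly
1/(ps) ≥ 1/2 - 1/N, both follow from the Sobolev embedding of H¹.

Each half of the functional is thus B(Φ(u), Φ(u)), with B bounded bilinear and Φ the embedding
followed by u ↦ |u|^p. The power map is C¹ from L^(ps) to L^s (`contDiff_powLp`): for p ≥ 2 the
pointwise Taylor remainder is quadratic in the increment, and Hölder's inequality turns this into a
bound on norms. Absolute convergence comes from Fubini's theorem
(`ConvolutionBound.ae_convolutionExistsAt`, `integrable_convolution_mul`).

The Sobolev inequality is first proved for compactly supported C¹ functions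
(`exists_eLpNorm_le_of_contDiff`), then carried to weak gradients by mollification, cutoff and
Fatou's lemma. -/

namespace Choquard

open Filter Topology ENNReal Convolution

/-! ### Pointwise estimates for |x|^p and its derivative. -/

section PowerFunction

theorem hasDerivAt_abs_rpow_mul {p : ℝ} (hp : 2 ≤ p) (x : ℝ) :
    HasDerivAt (fun x : ℝ => |x| ^ (p - 2) * x) ((p - 1) * |x| ^ (p - 2)) x := by
  rcases hp.eq_or_lt with rfl | hp
  · norm_num
    exact hasDerivAt_id' x
  rcases eq_or_ne x 0 with rfl | hx
  -- At the origin the difference quotient is |t|^(p-2), which tends to 0 since now p > 2.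
  · rw [hasDerivAt_iff_tendsto_slope_zero]
    have hc : Tendsto (fun t : ℝ => |t| ^ (p - 2)) (𝓝[≠] 0) (𝓝 (|0| ^ (p - 2))) :=
      ((continuous_abs.rpow_const fun _ => Or.inr (by linarith)).tendsto 0).mono_left
        nhdsWithin_le_nhds
    have h0 : (p - 1) * |(0 : ℝ)| ^ (p - 2) = |(0 : ℝ)| ^ (p - 2) := by
      rw [abs_zero, Real.zero_rpow (by linarith), mul_zero]
    rw [h0]
    refine hc.congr' ?_
    filter_upwards [self_mem_nhdsWithin] with t ht
    have ht : t ≠ 0 := ht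
    simp [field]
  · have h := ((hasDerivAt_abs hx).rpow_const (p := p - 2)
      (Or.inl (abs_ne_zero.2 hx))).mul (hasDerivAt_id' x)
    refine h.congr_deriv ?_
    have h1 : |x| ^ (p - 2) = |x| ^ (p - 2 - 1) * |x| := by
      rw [← Real.rpow_add_one (abs_ne_zero.2 hx)]; ring_nf
    have h2 : SignType.sign x * x = |x| := sign_mul_self x
    rw [h1]
    linear_combination (p - 2) * |x| ^ (p - 2 - 1) * h2

/-- Mean value inequality on the segment from x to x + h: as p ≥ 2, the derivative (p-1)|y|^(p-2) is
largest when |y| is, and |y| ≤ |x| + |h|. -/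
theorem abs_sub_abs_rpow_mul_le {p : ℝ} (hp : 2 ≤ p) (x h : ℝ) :
    |(|x + h| ^ (p - 2) * (x + h) - |x| ^ (p - 2) * x)| ≤
      (p - 1) * (|x| + |h|) ^ (p - 2) * |h| := by
  have key := (convex_segment (𝕜 := ℝ) x (x + h)).norm_image_sub_le_of_norm_hasDerivWithin_le
    (f := fun x : ℝ => |x| ^ (p - 2) * x) (f' := fun x => (p - 1) * |x| ^ (p - 2))
    (C := (p - 1) * (|x| + |h|) ^ (p - 2))
    (fun y _ => (hasDerivAt_abs_rpow_mul hp y).hasDerivWithinAt)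
    (fun y hy => ?_) (left_mem_segment ℝ x (x + h)) (right_mem_segment ℝ x (x + h))
  · simpa using key
  · rw [Real.norm_of_nonneg (mul_nonneg (by linarith) (by positivity))]
    have hy' : |y| ≤ |x| + |h| := by
      obtain ⟨t, ⟨ht0, ht1⟩, rfl⟩ := (segment_eq_image' ℝ x (x + h)) ▸ hy
      have : |t * h| ≤ |h| := by
        rw [abs_mul, abs_of_nonneg ht0]; exact mul_le_of_le_one_left (abs_nonneg _) ht1
      calc |x + t • (x + h - x)| = |x + t * h| := by simp
        _ ≤ |x| + |h| := (abs_add_le _ _).trans (by linarith)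
    gcongr
    linarith

/-- Mean value inequality on [0, 1] for t ↦ |x + th|^p minus its linear part. The derivative in t is
a difference of signed powers, so the first-order bound suffices and no second derivative of |x|^p
is needed. -/
theorem abs_rpow_taylor_le {p : ℝ} (hp : 2 ≤ p) (x h : ℝ) :
    |(|x + h| ^ p - |x| ^ p - p * (|x| ^ (p - 2) * x * h))| ≤
      p * (p - 1) * (|x| + |h|) ^ (p - 2) * |h| ^ 2 := by
  have hd : ∀ t : ℝ, HasDerivAt (fun t : ℝ => |x + t * h| ^ p - p * (|x| ^ (p - 2) * x) * (t * h))
      (p * (|x + t * h| ^ (p - 2) * (x + t * h) - |x| ^ (p - 2) * x) * h) t := by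
    intro t
    have h0 : HasDerivAt (fun t : ℝ => t * h) h t := by
      simpa using (hasDerivAt_id' t).mul_const h
    have h1 := (hasDerivAt_abs_rpow (x + t * h) (show 1 < p by linarith)).comp t
      (h0.const_add x)
    refine (h1.sub (h0.const_mul (p * (|x| ^ (p - 2) * x)))).congr_deriv ?_
    ring
  have key := (convex_Icc (0 : ℝ) 1).norm_image_sub_le_of_norm_hasDerivWithin_le
    (C := p * (p - 1) * (|x| + |h|) ^ (p - 2) * |h| ^ 2)
    (fun t _ => (hd t).hasDerivWithinAt) (fun t ht => ?_)
    (Set.left_mem_Icc.2 zero_le_one) (Set.right_mem_Icc.2 zero_le_one)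
  · simp only [one_mul, zero_mul, add_zero, mul_zero, sub_zero, norm_one, mul_one,
      Real.norm_eq_abs] at key
    refine le_of_eq_of_le (congrArg _ ?_) key
    ring
  · have ht' : |t * h| ≤ |h| := by
      rw [abs_mul, abs_of_nonneg ht.1]; exact mul_le_of_le_one_left (abs_nonneg _) ht.2
    have := abs_sub_abs_rpow_mul_le hp x (t * h)
    have hp0 : 0 ≤ p := by linarith
    have hp1 : 0 ≤ p - 1 := by linarith
    have hp2 : 0 ≤ p - 2 := by linarith
    rw [Real.norm_eq_abs, abs_mul, abs_mul, abs_of_nonneg hp0]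
    calc p * |(|x + t * h| ^ (p - 2) * (x + t * h) - |x| ^ (p - 2) * x)| * |h|
        ≤ p * ((p - 1) * (|x| + |h|) ^ (p - 2) * |h|) * |h| := by
          gcongr
          refine this.trans ?_
          gcongr
      _ = _ := by ring

end PowerFunction

/-! ### Differentiability of u ↦ |u|^p between Lebesgue spaces. -/

section LpPower

variable {α : Type*} {m : MeasurableSpace α} {μ : Measure α}

/-- Hölder's inequality for a function dominated by `|f|^a |g|^b`. -/
theorem eLpNorm_le_rpow_mul_rpow {F f g : α → ℝ} {a b r s : ℝ} (ha : 0 ≤ a) (hb : 0 ≤ b)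
    (hs : 0 < s) (hr : 0 < r) (hrs : (a + b) * s = r) (c : ℝ≥0∞)
    (hf : AEStronglyMeasurable f μ) (hg : AEStronglyMeasurable g μ)
    (h : ∀ᵐ x ∂μ, ‖F x‖ₑ ≤ c * (‖f x‖ₑ ^ a * ‖g x‖ₑ ^ b)) :
    eLpNorm F (.ofReal s) μ ≤
      c * (eLpNorm f (.ofReal r) μ ^ a * eLpNorm g (.ofReal r) μ ^ b) := by
  have e : ∀ (f : α → ℝ) {t : ℝ}, 0 < t →
      eLpNorm f (.ofReal t) μ = (∫⁻ x, ‖f x‖ₑ ^ t ∂μ) ^ (1 / t) := fun f t ht => by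
    rw [eLpNorm_eq_lintegral_rpow_enorm_toReal (by simpa) (by simp), ENNReal.toReal_ofReal ht.le]
  have hab : 0 < a + b := pos_of_mul_pos_left (hrs ▸ hr) hs.le
  rw [e F hs, e f hr, e g hr]
  have h1 : ∫⁻ x, ‖F x‖ₑ ^ s ∂μ ≤ c ^ s * ((∫⁻ x, ‖f x‖ₑ ^ r ∂μ) ^ (a / (a + b)) *
      (∫⁻ x, ‖g x‖ₑ ^ r ∂μ) ^ (b / (a + b))) := by
    calc ∫⁻ x, ‖F x‖ₑ ^ s ∂μ
        ≤ ∫⁻ x, c ^ s * ((‖f x‖ₑ ^ r) ^ (a / (a + b)) * (‖g x‖ₑ ^ r) ^ (b / (a + b))) ∂μ := by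
          refine lintegral_mono_ae (h.mono fun x hx => ?_)
          refine (ENNReal.rpow_le_rpow hx hs.le).trans_eq ?_
          rw [ENNReal.mul_rpow_of_nonneg _ _ hs.le, ENNReal.mul_rpow_of_nonneg _ _ hs.le,
            ← ENNReal.rpow_mul, ← ENNReal.rpow_mul, ← ENNReal.rpow_mul, ← ENNReal.rpow_mul]
          -- As (a + b)s = r, both factors become r-th powers raised to Hölder weights of sum 1.
          have ea : a * s = r * (a / (a + b)) := by rw [← hrs]; field_simp
          have eb : b * s = r * (b / (a + b)) := by rw [← hrs]; field_simp
          rw [ea, eb]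
      _ = c ^ s * ∫⁻ x, (‖f x‖ₑ ^ r) ^ (a / (a + b)) * (‖g x‖ₑ ^ r) ^ (b / (a + b)) ∂μ :=
          lintegral_const_mul'' _ (((hf.enorm.pow_const _).pow_const _).mul
            ((hg.enorm.pow_const _).pow_const _))
      _ ≤ _ := by
          gcongr
          exact ENNReal.lintegral_mul_norm_pow_le (hf.enorm.pow_const _) (hg.enorm.pow_const _)
            (by positivity) (by positivity) (by field_simp)
  refine (ENNReal.rpow_le_rpow h1 (by positivity)).trans_eq ?_
  have hs' : 0 ≤ 1 / s := by positivity
  rw [ENNReal.mul_rpow_of_nonneg _ _ hs', ENNReal.mul_rpow_of_nonneg _ _ hs',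
    ← ENNReal.rpow_mul, ← ENNReal.rpow_mul, ← ENNReal.rpow_mul, ← ENNReal.rpow_mul,
    ← ENNReal.rpow_mul, mul_one_div_cancel hs.ne', ENNReal.rpow_one]
  congr 3 <;> rw [← hrs] <;> field_simp

theorem norm_le_rpow_mul_rpow {a b r s : ℝ} (ha : 0 ≤ a) (hb : 0 ≤ b)
    (hs : 0 < s) (hr : 0 < r) (hrs : (a + b) * s = r) {c : ℝ} (hc : 0 ≤ c)
    (F : Lp ℝ (.ofReal s) μ) (f g : Lp ℝ (.ofReal r) μ)
    (h : ∀ᵐ x ∂μ, |F x| ≤ c * (|f x| ^ a * |g x| ^ b)) :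
    ‖F‖ ≤ c * (‖f‖ ^ a * ‖g‖ ^ b) := by
  have key := eLpNorm_le_rpow_mul_rpow ha hb hs hr hrs (.ofReal c) (Lp.aestronglyMeasurable f)
    (Lp.aestronglyMeasurable g) (F := F) (h.mono fun x hx => by
      simp only [Real.enorm_eq_ofReal_abs]
      rw [ENNReal.ofReal_rpow_of_nonneg (abs_nonneg _) ha,
        ENNReal.ofReal_rpow_of_nonneg (abs_nonneg _) hb, ← ENNReal.ofReal_mul (by positivity),
        ← ENNReal.ofReal_mul hc]
      exact ENNReal.ofReal_le_ofReal hx)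
  rw [Lp.norm_def, Lp.norm_def, Lp.norm_def, ENNReal.toReal_rpow, ENNReal.toReal_rpow,
    ← ENNReal.toReal_mul, ← ENNReal.toReal_ofReal hc, ← ENNReal.toReal_mul]
  have hf := (Lp.memLp f).2
  have hg := (Lp.memLp g).2
  exact ENNReal.toReal_mono (by finiteness) key

theorem memLp_of_abs_le_rpow {F f : α → ℝ} {a r s : ℝ} (ha : 0 ≤ a) (hs : 0 < s) (hr : 0 < r)
    (hrs : a * s = r) (hF : AEStronglyMeasurable F μ) (hf : MemLp f (.ofReal r) μ)
    (h : ∀ᵐ x ∂μ, |F x| ≤ |f x| ^ a) : MemLp F (.ofReal s) μ := by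
  refine ⟨hF, (eLpNorm_le_rpow_mul_rpow ha le_rfl hs hr (by rw [add_zero, hrs]) 1 hf.1 hf.1
    (h.mono fun x hx => ?_)).trans_lt ?_⟩
  · simp only [Real.enorm_eq_ofReal_abs]
    rw [ENNReal.ofReal_rpow_of_nonneg (abs_nonneg _) ha]
    simpa using ENNReal.ofReal_le_ofReal hx
  · have := hf.2
    simp only [rpow_zero, mul_one, one_mul]
    finiteness

variable {p r s : ℝ}

theorem memLp_abs_rpow (hp : 2 ≤ p) (hs : 0 < s) (hr : 0 < r) (hrs : p * s = r) {u : α → ℝ}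
    (hu : MemLp u (.ofReal r) μ) : MemLp (fun x => |u x| ^ p) (.ofReal s) μ :=
  memLp_of_abs_le_rpow (by linarith) hs hr hrs
    ((continuous_abs.rpow_const fun _ => Or.inr (by linarith)).comp_aestronglyMeasurable hu.1) hu
    (.of_forall fun x => by rw [abs_of_nonneg (by positivity)])

theorem memLp_abs_rpow_mul (hp : 2 ≤ p) {t : ℝ} (ht : 0 < t) (hr : 0 < r)
    (hrt : (p - 1) * t = r) {u : α → ℝ}
    (hu : MemLp u (.ofReal r) μ) : MemLp (fun x => |u x| ^ (p - 2) * u x) (.ofReal t) μ := by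
  refine memLp_of_abs_le_rpow (by linarith) ht hr hrt
    (((continuous_abs.rpow_const fun _ => Or.inr (by linarith)).mul
      continuous_id).comp_aestronglyMeasurable hu.1) hu (.of_forall fun x => le_of_eq ?_)
  rw [abs_mul, abs_of_nonneg (by positivity), ← Real.rpow_add_one' (abs_nonneg _) (by linarith)]
  ring_nf

/-- The map `u ↦ |u|^p` from `L^(ps)` to `L^s`. -/
noncomputable def powLp (μ : Measure α) (hp : 2 ≤ p) (hs : 0 < s) (hr : 0 < r) (hrs : p * s = r)
    (u : Lp ℝ (.ofReal r) μ) : Lp ℝ (.ofReal s) μ :=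
  (memLp_abs_rpow hp hs hr hrs (Lp.memLp u)).toLp

theorem coeFn_powLp (hp : 2 ≤ p) (hs : 0 < s) (hr : 0 < r) (hrs : p * s = r)
    (u : Lp ℝ (.ofReal r) μ) : powLp μ hp hs hr hrs u =ᵐ[μ] fun x => |u x| ^ p :=
  MemLp.coeFn_toLp _

/-- The map `u ↦ |u|^(p-2) u` from `L^((p-1)t)` to `L^t`. -/
noncomputable def signedPowLp (μ : Measure α) (hp : 2 ≤ p) {t : ℝ} (ht : 0 < t) (hr : 0 < r)
    (hrt : (p - 1) * t = r) (u : Lp ℝ (.ofReal r) μ) : Lp ℝ (.ofReal t) μ :=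
  (memLp_abs_rpow_mul hp ht hr hrt (Lp.memLp u)).toLp

theorem coeFn_signedPowLp (hp : 2 ≤ p) {t : ℝ} (ht : 0 < t) (hr : 0 < r)
    (hrt : (p - 1) * t = r) (u : Lp ℝ (.ofReal r) μ) :
    signedPowLp μ hp ht hr hrt u =ᵐ[μ] fun x => |u x| ^ (p - 2) * u x :=
  MemLp.coeFn_toLp _

/-- The pointwise bound integrated by Hölder's inequality with powers p-2 and 1, whose sum p-1
matches (p-1)t = r. -/
theorem norm_signedPowLp_sub_le (hp : 2 ≤ p) {t : ℝ} (ht : 0 < t) (hr : 0 < r)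
    (hrt : (p - 1) * t = r) [Fact (1 ≤ ENNReal.ofReal r)] (u v : Lp ℝ (.ofReal r) μ) :
    ‖signedPowLp μ hp ht hr hrt v - signedPowLp μ hp ht hr hrt u‖ ≤
      (p - 1) * ((‖u‖ + ‖v - u‖) ^ (p - 2) * ‖v - u‖) := by
  have hp2 : 0 ≤ p - 2 := by linarith
  have h := norm_le_rpow_mul_rpow (a := p - 2) (b := 1) hp2 zero_le_one ht hr
    (by rw [← hrt]; ring) (show 0 ≤ p - 1 by linarith)
    (signedPowLp μ hp ht hr hrt v - signedPowLp μ hp ht hr hrt u) (|u| + |v - u|) (v - u) (by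
      filter_upwards [Lp.coeFn_sub (signedPowLp μ hp ht hr hrt v) (signedPowLp μ hp ht hr hrt u),
        coeFn_signedPowLp hp ht hr hrt v, coeFn_signedPowLp hp ht hr hrt u,
        Lp.coeFn_add |u| |v - u|, Lp.coeFn_abs u, Lp.coeFn_abs (v - u),
        Lp.coeFn_sub v u] with x h1 h2 h3 h4 h5 h6 h7
      have := abs_sub_abs_rpow_mul_le hp (u x) (v x - u x)
      rw [h1, Pi.sub_apply, h2, h3, h4, Pi.add_apply, h5, h6, h7, Pi.sub_apply, Real.rpow_one,
        abs_of_nonneg (by positivity : 0 ≤ |u x| + |v x - u x|), ← mul_assoc]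
      simpa using this)
  rw [Real.rpow_one] at h
  refine h.trans ?_
  have : ‖|u| + |v - u|‖ ≤ ‖u‖ + ‖v - u‖ := by
    simpa only [norm_abs_eq_norm] using norm_add_le |u| |v - u|
  have hp1 : 0 ≤ p - 1 := by linarith
  gcongr

theorem continuous_signedPowLp (hp : 2 ≤ p) {t : ℝ} (ht : 0 < t) (hr : 0 < r)
    (hrt : (p - 1) * t = r) [Fact (1 ≤ ENNReal.ofReal r)] [Fact (1 ≤ ENNReal.ofReal t)] :
    Continuous (signedPowLp μ hp ht hr hrt) := by
  rw [continuous_iff_continuousAt]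
  intro u
  rw [ContinuousAt, tendsto_iff_norm_sub_tendsto_zero]
  refine squeeze_zero (fun _ => norm_nonneg _)
    (fun v => norm_signedPowLp_sub_le hp ht hr hrt u v) ?_
  have hc : Continuous fun v : Lp ℝ (.ofReal r) μ =>
      (p - 1) * ((‖u‖ + ‖v - u‖) ^ (p - 2) * ‖v - u‖) := by
    have : Continuous fun v : Lp ℝ (.ofReal r) μ => ‖v - u‖ := by fun_prop
    exact continuous_const.mul (((continuous_const.add this).rpow_const
      fun _ => Or.inr (by linarith)).mul this)
  simpa using hc.tendsto u

/-- The candidate derivative h ↦ p|u|^(p-2)u h is a Hölder product L^t × L^r → L^s. The remainder is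
estimated with powers p-2 and 2, of sum p. -/
theorem norm_powLp_taylor_le (hp : 2 ≤ p) (hs : 0 < s) (hr : 0 < r) (hrs : p * s = r)
    {t : ℝ} (ht : 0 < t) (hrt : (p - 1) * t = r) [Fact (1 ≤ ENNReal.ofReal r)]
    [HolderTriple (.ofReal t) (.ofReal r) (.ofReal s)]
    (u v : Lp ℝ (.ofReal r) μ) :
    ‖powLp μ hp hs hr hrs v - powLp μ hp hs hr hrs u -
      p • (ContinuousLinearMap.mul ℝ ℝ).holder (.ofReal s) (signedPowLp μ hp ht hr hrt u)
        (v - u)‖ ≤ p * (p - 1) * ((‖u‖ + ‖v - u‖) ^ (p - 2) * ‖v - u‖ ^ 2) := by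
  have hp2 : 0 ≤ p - 2 := by linarith
  have hpp : 0 ≤ p * (p - 1) := mul_nonneg (by linarith) (by linarith)
  set D := (ContinuousLinearMap.mul ℝ ℝ).holder (.ofReal s) (signedPowLp μ hp ht hr hrt u)
    (v - u) with hD
  have h := norm_le_rpow_mul_rpow (a := p - 2) (b := 2) hp2 zero_le_two hs hr
    (by rw [← hrs]; ring) hpp
    (powLp μ hp hs hr hrs v - powLp μ hp hs hr hrs u - p • D) (|u| + |v - u|) (v - u) (by
      filter_upwards [Lp.coeFn_sub (powLp μ hp hs hr hrs v - powLp μ hp hs hr hrs u) (p • D),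
        Lp.coeFn_sub (powLp μ hp hs hr hrs v) (powLp μ hp hs hr hrs u),
        Lp.coeFn_smul p D,
        (ContinuousLinearMap.mul ℝ ℝ).coeFn_holder (r := .ofReal s)
          (signedPowLp μ hp ht hr hrt u) (v - u),
        coeFn_powLp hp hs hr hrs v, coeFn_powLp hp hs hr hrs u,
        coeFn_signedPowLp hp ht hr hrt u,
        Lp.coeFn_add |u| |v - u|, Lp.coeFn_abs u, Lp.coeFn_abs (v - u),
        Lp.coeFn_sub v u] with x h1 h2 h3 h4 h5 h6 h7 h8 h9 h10 h11
      have := abs_rpow_taylor_le hp (u x) (v x - u x)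
      rw [h1, Pi.sub_apply, h2, Pi.sub_apply, h3, Pi.smul_apply, hD, h4, h5, h6, h7, h8,
        Pi.add_apply, h9, h10, h11, Pi.sub_apply,
        abs_of_nonneg (by positivity : 0 ≤ |u x| + |v x - u x|), ← mul_assoc]
      simpa using this)
  rw [Real.rpow_two] at h
  refine h.trans ?_
  have : ‖|u| + |v - u|‖ ≤ ‖u‖ + ‖v - u‖ := by
    simpa only [norm_abs_eq_norm] using norm_add_le |u| |v - u|
  gcongr

/-- The quadratic remainder gives the derivative at u. That derivative is a bounded linear image of
|u|^(p-2)u, hence continuous in u. -/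
theorem contDiff_powLp (hp : 2 ≤ p) (hs : 1 ≤ s) (hr : 0 < r) (hrs : p * s = r)
    [Fact (1 ≤ ENNReal.ofReal r)] [Fact (1 ≤ ENNReal.ofReal s)] :
    ContDiff ℝ 1 (powLp μ hp (zero_lt_one.trans_le hs) hr hrs) := by
  have hs0 : 0 < s := zero_lt_one.trans_le hs
  have hp1 : 0 < p - 1 := by linarith
  -- The exponent t = r/(p-1) satisfies 1/t + 1/r = p/r = 1/s, and t ≥ 1 because r = ps ≥ p.
  have ht1 : 1 ≤ r / (p - 1) := by rw [le_div_iff₀ hp1, ← hrs]; nlinarith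
  have ht : 0 < r / (p - 1) := zero_lt_one.trans_le ht1
  have hrt : (p - 1) * (r / (p - 1)) = r := by field_simp
  have : Fact (1 ≤ ENNReal.ofReal (r / (p - 1))) := ⟨by simpa using ENNReal.ofReal_le_ofReal ht1⟩
  have : HolderTriple (.ofReal (r / (p - 1))) (.ofReal r) (.ofReal s) := ⟨by
    rw [← ENNReal.ofReal_inv_of_pos ht, ← ENNReal.ofReal_inv_of_pos hr,
      ← ENNReal.ofReal_inv_of_pos hs0, ← ENNReal.ofReal_add (by positivity) (by positivity)]
    congr 1
    rw [← hrs]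
    have : p ≠ 0 := by linarith
    field_simp
    ring⟩
  rw [contDiff_one_iff_hasFDerivAt]
  refine ⟨fun u => p • (ContinuousLinearMap.mul ℝ ℝ).holderL μ (.ofReal (r / (p - 1)))
    (.ofReal r) (.ofReal s) (signedPowLp μ hp ht hr hrt u), ?_, fun u => ?_⟩
  · exact ((ContinuousLinearMap.continuous _).comp
      (continuous_signedPowLp hp ht hr hrt)).const_smul p
  · rw [hasFDerivAt_iff_tendsto]
    refine squeeze_zero (g := fun v => p * (p - 1) * ((‖u‖ + ‖v - u‖) ^ (p - 2) * ‖v - u‖))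
      (fun _ => by positivity) (fun v => ?_) ?_
    · rcases eq_or_ne v u with rfl | hv
      · simp
      have hv' : 0 < ‖v - u‖ := norm_pos_iff.2 (sub_ne_zero.2 hv)
      rw [inv_mul_le_iff₀ hv']
      refine (norm_powLp_taylor_le hp hs0 hr hrs ht hrt u v).trans_eq ?_
      ring
    · have hc : Continuous fun v : Lp ℝ (.ofReal r) μ =>
          p * (p - 1) * ((‖u‖ + ‖v - u‖) ^ (p - 2) * ‖v - u‖) := by
        have : Continuous fun v : Lp ℝ (.ofReal r) μ => ‖v - u‖ := by fun_prop
        exact continuous_const.mul (((continuous_const.add this).rpow_const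
          fun _ => Or.inr (by linarith)).mul this)
      simpa using hc.tendsto u

end LpPower

/-! ### Young's inequality and the bilinear convolution form. -/

section ConvolutionForm

variable {N : ℕ}

/-- Lebesgue measure on `ℝ^N × ℝ^N`. -/
noncomputable abbrev prodVolume (N : ℕ) : Measure (RN N × RN N) := volume.prod volume

theorem quasiMeasurePreserving_sub (N : ℕ) :
    Measure.QuasiMeasurePreserving (fun z : RN N × RN N => z.1 - z.2) (prodVolume N) volume :=
  quasiMeasurePreserving_sub_of_right_invariant volume volume

theorem lintegral_sub_mul {f g : RN N → ℝ≥0∞} (hf : AEMeasurable f volume)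
    (hg : AEMeasurable g volume) :
    ∫⁻ z, f (z.1 - z.2) * g z.1 ∂(prodVolume N) = (∫⁻ x, f x) * ∫⁻ x, g x := by
  rw [lintegral_prod (fun z : RN N × RN N => f (z.1 - z.2) * g z.1)
    ((hf.comp_quasiMeasurePreserving (quasiMeasurePreserving_sub N)).mul hg.comp_fst)]
  calc ∫⁻ x, ∫⁻ y, f (x - y) * g x = ∫⁻ x, (∫⁻ y, f y) * g x := by
        refine lintegral_congr fun x => ?_
        rw [lintegral_mul_const'' (f := fun y => f (x - y)) _ (hf.comp_quasiMeasurePreserving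
          (quasiMeasurePreserving_sub_left_of_right_invariant volume x)),
          lintegral_sub_left_eq_self f x]
    _ = _ := lintegral_const_mul'' _ hg

theorem lintegral_sub_mul_snd {f g : RN N → ℝ≥0∞} (hf : AEMeasurable f volume)
    (hg : AEMeasurable g volume) :
    ∫⁻ z, f (z.1 - z.2) * g z.2 ∂(prodVolume N) = (∫⁻ x, f x) * ∫⁻ x, g x := by
  rw [lintegral_prod_symm (fun z : RN N × RN N => f (z.1 - z.2) * g z.2)
    ((hf.comp_quasiMeasurePreserving (quasiMeasurePreserving_sub N)).mul hg.comp_snd)]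
  calc ∫⁻ y, ∫⁻ x, f (x - y) * g y = ∫⁻ y, (∫⁻ x, f x) * g y := by
        refine lintegral_congr fun y => ?_
        rw [lintegral_mul_const'' (f := fun x => f (x - y)) _ (hf.comp_quasiMeasurePreserving
          (measurePreserving_sub_right volume y).quasiMeasurePreserving),
          lintegral_sub_right_eq_self f y]
    _ = _ := lintegral_const_mul'' _ hg

/-- Young's convolution inequality, in the form of a bound for a trilinear integral. -/
theorem lintegral_convolution_mul_le {W f g : RN N → ℝ≥0∞} (hW : AEMeasurable W volume)
    (hf : AEMeasurable f volume) (hg : AEMeasurable g volume) {q s : ℝ} (hq : 1 ≤ q)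
    (hs : 1 / s = 1 - 1 / (2 * q)) :
    ∫⁻ z, W z.2 * (f (z.1 - z.2) * g z.1) ∂(prodVolume N) ≤
      (∫⁻ x, W x ^ q) ^ (1 / q) * ((∫⁻ x, f x ^ s) ^ (1 / s) * (∫⁻ x, g x ^ s) ^ (1 / s)) := by
  have hq0 : 0 < q := by linarith
  have hb : 0 ≤ 1 / (2 * q) := by positivity
  have hb1 : 1 / (2 * q) ≤ 1 / 2 := one_div_le_one_div_of_le two_pos (by linarith)
  have ha : 0 ≤ 1 - 1 / q := by
    rw [sub_nonneg, div_le_one hq0]; exact hq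
  have hs0 : 0 < s := one_div_pos.1 (by rw [hs]; linarith)
  have hab : 1 - 1 / q + 1 / (2 * q) = 1 / s := by rw [hs]; field_simp; ring
  have hbb : 1 / (2 * q) + 1 / (2 * q) = 1 / q := by field_simp; norm_num
  have hfs := hf.pow_const s
  have hgs := hg.pow_const s
  have hWq := hW.pow_const q
  have hQ := quasiMeasurePreserving_sub N
  set A := ∫⁻ x, f x ^ s
  set B := ∫⁻ x, g x ^ s
  set D := ∫⁻ x, W x ^ q
  -- With x = f^s, y = g^s, w = W^q, this writes W f g as a product of three pairings with Hölder
  -- weights of sum 1. Each pairing integrates to a product by Tonelli. The same identity, applied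
  -- to the integrals A, B, D, assembles the right-hand side.
  have comb : ∀ {x y w : ℝ≥0∞}, (x * y) ^ (1 - 1 / q) * (x * w) ^ (1 / (2 * q)) *
      (w * y) ^ (1 / (2 * q)) = w ^ (1 / q) * (x ^ (1 / s) * y ^ (1 / s)) := by
    intro x y w
    rw [ENNReal.mul_rpow_of_nonneg _ _ ha, ENNReal.mul_rpow_of_nonneg _ _ hb,
      ENNReal.mul_rpow_of_nonneg _ _ hb, ← hab, ENNReal.rpow_add_of_nonneg _ _ ha hb,
      ENNReal.rpow_add_of_nonneg _ _ ha hb, show w ^ (1 / q) = w ^ (1 / (2 * q)) * w ^ (1 / (2 * q))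
        by rw [← ENNReal.rpow_add_of_nonneg _ _ hb hb, hbb]]
    ring
  have key := ENNReal.lintegral_prod_norm_pow_le (μ := prodVolume N) (Finset.univ : Finset (Fin 3))
    (f := ![fun z => f (z.1 - z.2) ^ s * g z.1 ^ s, fun z => f (z.1 - z.2) ^ s * W z.2 ^ q,
      fun z => W z.2 ^ q * g z.1 ^ s]) (p := ![1 - 1 / q, 1 / (2 * q), 1 / (2 * q)])
    (by
      intro i _
      fin_cases i
      · exact (hfs.comp_quasiMeasurePreserving hQ).mul hgs.comp_fst
      · exact (hfs.comp_quasiMeasurePreserving hQ).mul hWq.comp_snd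
      · exact hWq.comp_snd.mul hgs.comp_fst)
    (by simp only [Fin.sum_univ_three, Matrix.cons_val]; rw [add_assoc, hbb]; ring)
    (by intro i _; fin_cases i; exacts [ha, hb, hb])
  simp only [Fin.prod_univ_three, Matrix.cons_val] at key
  have e1 : ∫⁻ z, f (z.1 - z.2) ^ s * g z.1 ^ s ∂(prodVolume N) = A * B := lintegral_sub_mul hfs hgs
  have e2 : ∫⁻ z, f (z.1 - z.2) ^ s * W z.2 ^ q ∂(prodVolume N) = A * D := lintegral_sub_mul_snd hfs hWq
  have e3 : ∫⁻ z, W z.2 ^ q * g z.1 ^ s ∂(prodVolume N) = D * B := by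
    simp_rw [mul_comm (W _ ^ q)]
    rw [lintegral_prod_mul hgs hWq, mul_comm]
  rw [e1, e2, e3, comb] at key
  refine le_of_eq_of_le (lintegral_congr fun z => ?_) key
  rw [comb, ← ENNReal.rpow_mul, ← ENNReal.rpow_mul, ← ENNReal.rpow_mul,
    mul_one_div_cancel hs0.ne', mul_one_div_cancel hq0.ne', ENNReal.rpow_one, ENNReal.rpow_one,
    ENNReal.rpow_one]

/-- The form `(f, g) ↦ ∫ (W ∗ f) g` is bounded by `C` on `L^s × L^s`. -/
def ConvolutionBound (W : RN N → ℝ) (s : ℝ≥0∞) (C : ℝ≥0∞) : Prop :=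
  ∀ f g : RN N → ℝ, AEStronglyMeasurable f volume → AEStronglyMeasurable g volume →
    ∫⁻ z, ‖W z.2 * (f (z.1 - z.2) * g z.1)‖ₑ ∂(prodVolume N) ≤ C * (eLpNorm f s volume * eLpNorm g s volume)

theorem convolutionBound_of_memLp {W : RN N → ℝ} {q s : ℝ} (hq : 1 ≤ q)
    (hs : 1 / s = 1 - 1 / (2 * q)) (hs0 : 0 < s) (hW : MemLp W (.ofReal q) volume) :
    ConvolutionBound W (.ofReal s) (eLpNorm W (.ofReal q) volume) := by
  intro f g hf hg
  have e : ∀ (f : RN N → ℝ) {t : ℝ}, 0 < t →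
      eLpNorm f (.ofReal t) volume = (∫⁻ x, ‖f x‖ₑ ^ t) ^ (1 / t) := fun f t ht => by
    rw [eLpNorm_eq_lintegral_rpow_enorm_toReal (by simpa) (by simp), ENNReal.toReal_ofReal ht.le]
  rw [e f hs0, e g hs0, e W (by linarith)]
  simp_rw [enorm_mul]
  exact lintegral_convolution_mul_le hW.1.enorm hf.enorm hg.enorm hq hs

/-- Once |W| is replaced by M, Tonelli and translation invariance separate the two L¹ norms. -/
theorem convolutionBound_of_bounded {W : RN N → ℝ} {M : ℝ} (hM : ∀ x, |W x| ≤ M) :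
    ConvolutionBound W 1 (.ofReal M) := by
  intro f g hf hg
  rw [eLpNorm_one_eq_lintegral_enorm, eLpNorm_one_eq_lintegral_enorm,
    ← lintegral_sub_mul hf.enorm hg.enorm, ← lintegral_const_mul''
      (f := fun z : RN N × RN N => ‖f (z.1 - z.2)‖ₑ * ‖g z.1‖ₑ) _
      ((hf.enorm.comp_quasiMeasurePreserving (quasiMeasurePreserving_sub N)).mul hg.enorm.comp_fst)]
  refine lintegral_mono fun z => ?_
  simp only [enorm_mul]
  gcongr
  rw [Real.enorm_eq_ofReal_abs]
  exact ENNReal.ofReal_le_ofReal (hM _)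

theorem aestronglyMeasurable_convolution_mul {W f g : RN N → ℝ}
    (hW : AEStronglyMeasurable W volume) (hf : AEStronglyMeasurable f volume)
    (hg : AEStronglyMeasurable g volume) :
    AEStronglyMeasurable (fun z : RN N × RN N => W z.2 * (f (z.1 - z.2) * g z.1)) (prodVolume N) :=
  hW.comp_snd.mul ((hf.comp_quasiMeasurePreserving (quasiMeasurePreserving_sub N)).mul hg.comp_fst)

theorem ConvolutionBound.integrable {W : RN N → ℝ} {s C : ℝ≥0∞} (h : ConvolutionBound W s C)
    (hC : C ≠ ⊤) (hW : AEStronglyMeasurable W volume) {f g : RN N → ℝ} (hf : MemLp f s volume)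
    (hg : MemLp g s volume) :
    Integrable (fun z : RN N × RN N => W z.2 * (f (z.1 - z.2) * g z.1)) (prodVolume N) := by
  refine ⟨aestronglyMeasurable_convolution_mul hW hf.1 hg.1, (h f g hf.1 hg.1).trans_lt ?_⟩
  have := hf.2
  have := hg.2
  finiteness

/-- The form descends to almost-everywhere classes because (x, y) ↦ x - y pulls null sets back to
null sets. -/
theorem integral_convolution_mul_congr {W f f' g g' : RN N → ℝ} (hf : f =ᵐ[volume] f')
    (hg : g =ᵐ[volume] g') :
    ∫ z, W z.2 * (f (z.1 - z.2) * g z.1) ∂(prodVolume N) =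
      ∫ z, W z.2 * (f' (z.1 - z.2) * g' z.1) ∂(prodVolume N) := by
  refine integral_congr_ae ?_
  filter_upwards [(quasiMeasurePreserving_sub N).ae_eq_comp hf,
    (Measure.quasiMeasurePreserving_fst (μ := volume) (ν := volume)).ae_eq_comp hg] with z h1 h2
  have h1 : f (z.1 - z.2) = f' (z.1 - z.2) := h1
  have h2 : g z.1 = g' z.1 := h2
  rw [h1, h2]

/-- A bounded convolution form, as a continuous bilinear form on `L^s`. -/
theorem ConvolutionBound.exists_bilinear {W : RN N → ℝ} {s C : ℝ≥0∞} (h : ConvolutionBound W s C)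
    (hC : C ≠ ⊤) (hW : AEStronglyMeasurable W volume) [Fact (1 ≤ s)] :
    ∃ B : Lp ℝ s (volume : Measure (RN N)) →L[ℝ] Lp ℝ s (volume : Measure (RN N)) →L[ℝ] ℝ,
      ∀ f g, B f g = ∫ z, W z.2 * (f (z.1 - z.2) * g z.1) ∂(prodVolume N) := by
  have int : ∀ f g : Lp ℝ s (volume : Measure (RN N)),
      Integrable (fun z : RN N × RN N => W z.2 * (f (z.1 - z.2) * g z.1)) (prodVolume N) :=
    fun f g => h.integrable hC hW (Lp.memLp f) (Lp.memLp g)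
  let B₀ : Lp ℝ s (volume : Measure (RN N)) →ₗ[ℝ] Lp ℝ s (volume : Measure (RN N)) →ₗ[ℝ] ℝ :=
    LinearMap.mk₂ ℝ (fun f g => ∫ z, W z.2 * (f (z.1 - z.2) * g z.1) ∂(prodVolume N))
      (fun f f' g => by
        rw [← integral_add (int f g) (int f' g),
          integral_convolution_mul_congr (Lp.coeFn_add f f') (ae_eq_refl g)]
        exact integral_congr_ae (.of_forall fun z => by simp only [Pi.add_apply]; ring))
      (fun c f g => by
        rw [integral_convolution_mul_congr (Lp.coeFn_smul c f) (ae_eq_refl g), smul_eq_mul,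
          ← integral_const_mul]
        exact integral_congr_ae (.of_forall fun z => by
          simp only [Pi.smul_apply, smul_eq_mul]; ring))
      (fun f g g' => by
        rw [← integral_add (int f g) (int f g'),
          integral_convolution_mul_congr (ae_eq_refl f) (Lp.coeFn_add g g')]
        exact integral_congr_ae (.of_forall fun z => by simp only [Pi.add_apply]; ring))
      (fun c f g => by
        rw [integral_convolution_mul_congr (ae_eq_refl f) (Lp.coeFn_smul c g), smul_eq_mul,
          ← integral_const_mul]
        exact integral_congr_ae (.of_forall fun z => by
          simp only [Pi.smul_apply, smul_eq_mul]; ring))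
  refine ⟨B₀.mkContinuous₂ C.toReal fun f g => ?_, fun f g => rfl⟩
  have hf := (Lp.memLp f).2
  have hg := (Lp.memLp g).2
  calc ‖B₀ f g‖ ≤ (∫⁻ z, ‖W z.2 * (f (z.1 - z.2) * g z.1)‖ₑ ∂(prodVolume N)).toReal := by
        have := norm_integral_le_lintegral_norm (μ := prodVolume N)
          fun z => W z.2 * (f (z.1 - z.2) * g z.1)
        simp only [ofReal_norm] at this
        exact this
    _ ≤ (C * (eLpNorm f s volume * eLpNorm g s volume)).toReal :=
        ENNReal.toReal_mono (by finiteness)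
          (h f g (Lp.aestronglyMeasurable f) (Lp.aestronglyMeasurable g))
    _ = C.toReal * ‖f‖ * ‖g‖ := by
        rw [ENNReal.toReal_mul, ENNReal.toReal_mul, Lp.norm_def, Lp.norm_def, mul_assoc]

end ConvolutionForm

/-! ### Interpolation of Lebesgue norms. -/

section Interpolation

variable {α : Type*} {m : MeasurableSpace α} {μ : Measure α}

theorem lintegral_rpow_le_of_eLpNorm_le {u : α → ℝ} {t : ℝ} (ht : 0 < t) {M : ℝ≥0∞}
    (h : eLpNorm u (.ofReal t) μ ≤ M) : ∫⁻ x, ‖u x‖ₑ ^ t ∂μ ≤ M ^ t := by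
  rw [eLpNorm_eq_lintegral_rpow_enorm_toReal (by simpa) (by simp), ENNReal.toReal_ofReal ht.le,
    one_div, ENNReal.rpow_inv_le_iff ht] at h
  exact h

theorem eLpNorm_le_of_lintegral_rpow_le {u : α → ℝ} {t : ℝ} (ht : 0 < t) {M : ℝ≥0∞}
    (h : ∫⁻ x, ‖u x‖ₑ ^ t ∂μ ≤ M ^ t) : eLpNorm u (.ofReal t) μ ≤ M := by
  rw [eLpNorm_eq_lintegral_rpow_enorm_toReal (by simpa) (by simp), ENNReal.toReal_ofReal ht.le,
    one_div, ENNReal.rpow_inv_le_iff ht]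
  exact h

/-- Interpolation between two Lebesgue spaces. -/
theorem eLpNorm_le_of_le_of_le {u : α → ℝ} (hu : AEStronglyMeasurable u μ) {a b r : ℝ}
    (ha : 0 < a) (har : a ≤ r) (hrb : r ≤ b) {M : ℝ≥0∞} (hMa : eLpNorm u (.ofReal a) μ ≤ M)
    (hMb : eLpNorm u (.ofReal b) μ ≤ M) : eLpNorm u (.ofReal r) μ ≤ M := by
  rcases har.eq_or_lt with rfl | har
  · exact hMa
  have hr : 0 < r := ha.trans har
  have hb : 0 < b := hr.trans_le hrb
  have hab : 0 < b - a := by linarith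
  have h1 : 0 ≤ (b - r) / (b - a) := div_nonneg (by linarith) hab.le
  have h2 : 0 ≤ (r - a) / (b - a) := div_nonneg (by linarith) hab.le
  have h12 : (b - r) / (b - a) + (r - a) / (b - a) = 1 := by field_simp; ring
  have hr' : a * ((b - r) / (b - a)) + b * ((r - a) / (b - a)) = r := by field_simp; ring
  have split : ∀ y : ℝ≥0∞, (y ^ a) ^ ((b - r) / (b - a)) * (y ^ b) ^ ((r - a) / (b - a)) = y ^ r := by
    intro y
    rw [← ENNReal.rpow_mul, ← ENNReal.rpow_mul, ← ENNReal.rpow_add_of_nonneg _ _ (by positivity)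
      (by positivity), hr']
  refine eLpNorm_le_of_lintegral_rpow_le hr ?_
  calc ∫⁻ x, ‖u x‖ₑ ^ r ∂μ
      = ∫⁻ x, (‖u x‖ₑ ^ a) ^ ((b - r) / (b - a)) * (‖u x‖ₑ ^ b) ^ ((r - a) / (b - a)) ∂μ := by
        simp_rw [split]
    _ ≤ (∫⁻ x, ‖u x‖ₑ ^ a ∂μ) ^ ((b - r) / (b - a)) *
        (∫⁻ x, ‖u x‖ₑ ^ b ∂μ) ^ ((r - a) / (b - a)) :=
        ENNReal.lintegral_mul_norm_pow_le (hu.enorm.pow_const _) (hu.enorm.pow_const _) h1 h2 h12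
    _ ≤ (M ^ a) ^ ((b - r) / (b - a)) * (M ^ b) ^ ((r - a) / (b - a)) := by
        gcongr
        · exact lintegral_rpow_le_of_eLpNorm_le ha hMa
        · exact lintegral_rpow_le_of_eLpNorm_le hb hMb
    _ = M ^ r := split M

/-- The endpoint b = ∞ of the interpolation: |u|^(r-a) is bounded by M^(r-a). -/
theorem eLpNorm_le_of_le_of_bounded {u : α → ℝ} (hu : AEStronglyMeasurable u μ) {a r : ℝ}
    (ha : 0 < a) (har : a ≤ r) {M : ℝ≥0∞} (hMa : eLpNorm u (.ofReal a) μ ≤ M)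
    (hM : ∀ x, ‖u x‖ₑ ≤ M) : eLpNorm u (.ofReal r) μ ≤ M := by
  have hra : 0 ≤ r - a := by linarith
  refine eLpNorm_le_of_lintegral_rpow_le (ha.trans_le har) ?_
  calc ∫⁻ x, ‖u x‖ₑ ^ r ∂μ ≤ ∫⁻ x, ‖u x‖ₑ ^ a * M ^ (r - a) ∂μ := by
        refine lintegral_mono fun x => ?_
        dsimp only
        rw [show r = a + (r - a) by ring, ENNReal.rpow_add_of_nonneg _ _ ha.le hra, add_sub_cancel]
        gcongr
        exact hM x
    _ = (∫⁻ x, ‖u x‖ₑ ^ a ∂μ) * M ^ (r - a) := lintegral_mul_const'' _ (hu.enorm.pow_const _)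
    _ ≤ M ^ a * M ^ (r - a) := by
        gcongr
        exact lintegral_rpow_le_of_eLpNorm_le ha hMa
    _ = M ^ r := by rw [← ENNReal.rpow_add_of_nonneg _ _ ha.le hra, add_sub_cancel]

end Interpolation

/-! ### Sobolev inequalities for compactly supported C¹ functions. -/

section SmoothSobolev

variable {N : ℕ}

/-- Chain rule and Cauchy–Schwarz. In dimensions 1 and 2, L¹ gradient inequalities applied to powers
of u then yield bounds in terms of L² data. -/
theorem eLpNorm_fderiv_pow_le {u : RN N → ℝ} (hu : ContDiff ℝ 1 u) (k : ℕ) :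
    eLpNorm (fderiv ℝ fun x => u x ^ (k + 1)) 1 volume ≤
      (k + 1) * (eLpNorm (fun x => u x ^ k) 2 volume * eLpNorm (fderiv ℝ u) 2 volume) := by
  have h : (fderiv ℝ fun x => u x ^ (k + 1)) =
      ((k + 1 : ℕ) : ℝ) • ((fun x => u x ^ k) • fderiv ℝ u) := by
    funext x
    have := ((hu.differentiable one_ne_zero x).hasFDerivAt.pow (k + 1)).fderiv
    refine this.trans ?_
    simp [mul_smul]
  rw [h, eLpNorm_const_smul ((k + 1 : ℕ) : ℝ) ((fun x => u x ^ k) • fderiv ℝ u)]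
  have : ‖((k + 1 : ℕ) : ℝ)‖ₑ = k + 1 := by
    rw [Real.enorm_eq_ofReal_abs, abs_of_nonneg (by positivity), ENNReal.ofReal_natCast]
    simp
  rw [this]
  gcongr
  exact eLpNorm_smul_le_mul_eLpNorm (hu.continuous_fderiv one_ne_zero).aestronglyMeasurable
    (hu.continuous.pow k).aestronglyMeasurable

theorem eLpNorm_pow_two (u : RN N → ℝ) (k : ℕ) :
    eLpNorm (fun x => u x ^ (k + 1)) 2 volume =
      eLpNorm u (.ofReal (2 * (k + 1 : ℕ))) volume ^ (k + 1) := by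
  have h := eLpNorm_norm_rpow (p := 2) (μ := volume) u (q := (k + 1 : ℕ)) (by positivity)
  rw [ENNReal.rpow_natCast] at h
  rw [ENNReal.ofReal_mul zero_le_two, ENNReal.ofReal_ofNat, ← h]
  refine eLpNorm_congr_norm_ae (.of_forall fun x => ?_)
  rw [Real.rpow_natCast, norm_pow, norm_pow, norm_norm]

/-- The fundamental theorem of calculus, transported from ℝ by a measure-preserving linear isometry.
-/
theorem enorm_le_lintegral_fderiv_one_dim {v : RN 1 → ℝ} (hv : ContDiff ℝ 1 v)
    (hc : HasCompactSupport v) (x : RN 1) : ‖v x‖ₑ ≤ ∫⁻ y, ‖fderiv ℝ v y‖ₑ := by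
  let e : ℝ ≃ₗᵢ[ℝ] RN 1 := (OrthonormalBasis.singleton (Fin 1) ℝ).repr
  have h1 : ContDiff ℝ 1 (v ∘ e) := hv.comp e.contDiff
  have h2 : HasCompactSupport (v ∘ e) := hc.comp_homeomorph e.toHomeomorph
  calc ‖v x‖ₑ = ‖(v ∘ e) (e.symm x)‖ₑ := by simp
    _ ≤ ∫⁻ y in Set.Iic (e.symm x), ‖deriv (v ∘ e) y‖ₑ := h2.enorm_le_lintegral_Ici_deriv h1 _
    _ ≤ ∫⁻ y, ‖deriv (v ∘ e) y‖ₑ := setLIntegral_le_lintegral _ _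
    _ ≤ ∫⁻ y, ‖fderiv ℝ v (e y)‖ₑ := by
        refine lintegral_mono fun y => ?_
        have hd : HasDerivAt e (e 1) y := by
          simpa using e.toContinuousLinearEquiv.toContinuousLinearMap.hasDerivAt (x := y)
        rw [((hv.differentiable one_ne_zero (e y)).hasFDerivAt.comp_hasDerivAt y hd).deriv]
        refine (ContinuousLinearMap.le_opENorm _ _).trans_eq ?_
        rw [show ‖e 1‖ₑ = 1 by rw [← ofReal_norm, e.norm_map]; simp, mul_one]
    _ = ∫⁻ y, ‖fderiv ℝ v y‖ₑ :=
        (OrthonormalBasis.measurePreserving_repr _).lintegral_comp_emb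
          e.toHomeomorph.measurableEmbedding fun y => ‖fderiv ℝ v y‖ₑ

/-- The Sobolev inequality in dimension one. -/
theorem eLpNorm_le_of_contDiff_one_dim {r : ℝ} (hr : 2 ≤ r) {u : RN 1 → ℝ}
    (hu : ContDiff ℝ 1 u) (hc : HasCompactSupport u) {M : ℝ≥0∞} (h2 : eLpNorm u 2 volume ≤ M)
    (hd : eLpNorm (fderiv ℝ u) 2 volume ≤ M) : eLpNorm u (.ofReal r) volume ≤ 2 * M := by
  refine eLpNorm_le_of_le_of_bounded hu.continuous.aestronglyMeasurable two_pos hr ?_ fun x => ?_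
  · rw [ENNReal.ofReal_ofNat, two_mul]
    exact h2.trans le_self_add
  -- Applied to u², this gives |u(x)|² ≤ 2‖u‖₂‖∇u‖₂ ≤ 2M², enlarged to the square (2M)².
  · have h := enorm_le_lintegral_fderiv_one_dim (v := fun x => u x ^ (1 + 1)) (hu.pow _)
      (hc.comp_left (g := fun y : ℝ => y ^ (1 + 1)) (by simp)) x
    rw [← eLpNorm_one_eq_lintegral_enorm] at h
    have h' := h.trans (eLpNorm_fderiv_pow_le hu 1)
    rw [enorm_pow] at h'
    simp only [pow_one, Nat.cast_one, one_add_one_eq_two] at h'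
    refine (ENNReal.pow_le_pow_left_iff two_ne_zero).1 (h'.trans ?_)
    calc 2 * (eLpNorm u 2 volume * eLpNorm (fderiv ℝ u) 2 volume) ≤ 4 * (M * M) := by
          gcongr
          norm_num
      _ = (2 * M) ^ 2 := by ring

/-- In the plane an L¹ gradient bound controls the L² norm. For u^(k+2) this bounds the (k+2)-th
power of the L^(2(k+2)) norm of u by K(k+2) times ‖∇u‖₂ and the (k+1)-th power of its L^(2(k+1))
norm, so induction reaches every even exponent. -/
theorem exists_eLpNorm_le_even_two_dim (k : ℕ) : ∃ C : NNReal, ∀ u : RN 2 → ℝ, ContDiff ℝ 1 u →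
    HasCompactSupport u → ∀ M : ℝ≥0∞, eLpNorm u 2 volume ≤ M →
      eLpNorm (fderiv ℝ u) 2 volume ≤ M →
        eLpNorm u (.ofReal (2 * (k + 1 : ℕ))) volume ≤ C * M := by
  induction k with
  | zero => exact ⟨1, fun u _ _ M h _ => by simpa using h⟩
  | succ k ih =>
    obtain ⟨C, hC⟩ := ih
    set K : NNReal := eLpNormLESNormFDerivOneConst (volume : Measure (RN 2)) (2 : NNReal)
    -- The summand 1 makes the constant at least 1, hence at most its own (k+2)-th power, which
    -- avoids extracting a root.
    refine ⟨1 + K * (k + 2) * C ^ (k + 1), fun u hu hc M h2 hd => ?_⟩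
    have hconj : NNReal.HolderConjugate (Module.finrank ℝ (RN 2)) 2 := by
      rw [finrank_euclideanSpace_fin]
      exact_mod_cast NNReal.HolderConjugate.two_two
    have hv := eLpNorm_le_eLpNorm_fderiv_one (volume : Measure (RN 2))
      (u := fun x => u x ^ (k + 1 + 1)) (hu.pow _)
      (hc.comp_left (g := fun y : ℝ => y ^ (k + 1 + 1)) (by simp)) hconj
    refine (ENNReal.pow_le_pow_left_iff (n := k + 1 + 1) (by simp)).1 ?_
    rw [← eLpNorm_pow_two]
    have hk : eLpNorm (fun x => u x ^ (k + 1)) 2 volume ≤ (C * M) ^ (k + 1) := by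
      rw [eLpNorm_pow_two]
      gcongr
      exact hC u hu hc M h2 hd
    calc eLpNorm (fun x => u x ^ (k + 1 + 1)) 2 volume
        ≤ K * (((k + 1 : ℕ) + 1) * ((C * M) ^ (k + 1) * M)) := by
          refine hv.trans ?_
          gcongr
          refine (eLpNorm_fderiv_pow_le hu (k + 1)).trans ?_
          gcongr
      _ = ((K * (k + 2) * C ^ (k + 1) : NNReal) : ℝ≥0∞) * M ^ (k + 1 + 1) := by
          push_cast
          ring
      _ ≤ ((1 + K * (k + 2) * C ^ (k + 1) : NNReal) ^ (k + 1 + 1) : NNReal) * M ^ (k + 1 + 1) := by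
          gcongr
          exact (le_add_of_nonneg_left zero_le_one).trans
            (le_self_pow₀ (le_add_of_nonneg_right zero_le) (by simp))
      _ = _ := by
          rw [mul_pow, ENNReal.coe_pow]

/-- The Sobolev inequality for compactly supported `C¹` functions on `ℝ^N`, for exponents up to the
critical one. -/
theorem exists_eLpNorm_le_of_contDiff (hN : 1 ≤ N) {r : ℝ} (hr : 2 ≤ r)
    (hNr : 1 / 2 - 1 / (N : ℝ) ≤ 1 / r) : ∃ C : NNReal, ∀ u : RN N → ℝ, ContDiff ℝ 1 u →
    HasCompactSupport u → ∀ M : ℝ≥0∞, eLpNorm u 2 volume ≤ M →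
      eLpNorm (fderiv ℝ u) 2 volume ≤ M → eLpNorm u (.ofReal r) volume ≤ C * M := by
  obtain rfl | rfl | hN3 : N = 1 ∨ N = 2 ∨ 3 ≤ N := by omega
  · exact ⟨2, fun u hu hc M h2 hd => by simpa using eLpNorm_le_of_contDiff_one_dim hr hu hc h2 hd⟩
  · obtain ⟨k, hk⟩ := exists_nat_ge r
    obtain ⟨C, hC⟩ := exists_eLpNorm_le_even_two_dim k
    refine ⟨1 + C, fun u hu hc M h2 hd => ?_⟩
    have e : ((1 + C : NNReal) : ℝ≥0∞) * M = M + C * M := by push_cast; ring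
    rw [e]
    refine eLpNorm_le_of_le_of_le hu.continuous.aestronglyMeasurable two_pos hr
      (b := 2 * (k + 1 : ℕ)) (by push_cast; linarith) ?_ ((hC u hu hc M h2 hd).trans le_add_self)
    rw [ENNReal.ofReal_ofNat]
    exact h2.trans le_self_add
  · have hN' : (3 : ℝ) ≤ N := by exact_mod_cast hN3
    have hN2 : (0 : ℝ) < N - 2 := by linarith
    -- The critical exponent: 1/b = 1/2 - 1/N, so the hypothesis on r reads r ≤ b and interpolation
    -- between 2 and b applies.
    let b : NNReal := ⟨2 * N / (N - 2), by positivity⟩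
    have hb : (b : ℝ) = 2 * N / (N - 2) := rfl
    set K : NNReal := eLpNormLESNormFDerivOfEqInnerConst (volume : Measure (RN N)) (2 : NNReal)
    refine ⟨1 + K, fun u hu hc M h2 hd => ?_⟩
    have hS := eLpNorm_le_eLpNorm_fderiv_of_eq_inner (volume : Measure (RN N)) hu hc
      (p := 2) (p' := b) one_le_two (by rw [finrank_euclideanSpace_fin]; omega) (by
        rw [hb, finrank_euclideanSpace_fin, NNReal.coe_inv, NNReal.coe_ofNat]
        field_simp)
    have e : ((1 + K : NNReal) : ℝ≥0∞) * M = M + K * M := by push_cast; ring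
    rw [e]
    refine eLpNorm_le_of_le_of_le hu.continuous.aestronglyMeasurable two_pos hr
      (b := b) ?_ ?_ ?_
    · have hbr : 1 / (b : ℝ) ≤ 1 / r := by
        refine le_of_eq_of_le ?_ hNr
        rw [hb]
        field_simp
      exact (one_div_le_one_div (by rw [hb]; positivity) (by linarith)).1 hbr
    · rw [ENNReal.ofReal_ofNat]
      exact h2.trans le_self_add
    · rw [ENNReal.ofReal_coe_nnreal]
      refine (hS.trans ?_).trans le_add_self
      gcongr
      exact_mod_cast hd

end SmoothSobolev

/-! ### Mollification, cutoff and the Sobolev inequality for weak gradients. -/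

section Mollification

variable {N : ℕ}

/-- Cauchy–Schwarz for the measure |η(x-t)| dt of mass 1 gives |f ∗ η|² ≤ |η| ∗ |f|² pointwise;
integrate by Tonelli. -/
theorem eLpNorm_convolution_le {f η : RN N → ℝ} (hf : AEStronglyMeasurable f volume)
    (hη : AEStronglyMeasurable η volume) (h1 : ∫⁻ x, ‖η x‖ₑ = 1) :
    eLpNorm (f ⋆[ContinuousLinearMap.mul ℝ ℝ] η) 2 volume ≤ eLpNorm f 2 volume := by
  have hη' : ∀ x : RN N, AEMeasurable (fun t => ‖η (x - t)‖ₑ) volume := fun x =>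
    (hη.comp_quasiMeasurePreserving
      (quasiMeasurePreserving_sub_left_of_right_invariant volume x)).enorm
  have key : ∀ x, ‖(f ⋆[ContinuousLinearMap.mul ℝ ℝ] η) x‖ₑ ^ (2 : ℝ) ≤
      ∫⁻ t, ‖η (x - t)‖ₑ * ‖f t‖ₑ ^ (2 : ℝ) := by
    intro x
    have hle : ‖(f ⋆[ContinuousLinearMap.mul ℝ ℝ] η) x‖ₑ ≤
        ∫⁻ t, ‖η (x - t)‖ₑ ^ (1 / 2 : ℝ) * (‖η (x - t)‖ₑ * ‖f t‖ₑ ^ (2 : ℝ)) ^ (1 / 2 : ℝ) := by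
      refine (enorm_integral_le_lintegral_enorm _).trans_eq (lintegral_congr fun t => ?_)
      rw [ENNReal.mul_rpow_of_nonneg _ _ (by norm_num), ← ENNReal.rpow_mul, ← mul_assoc,
        ← ENNReal.rpow_add_of_nonneg _ _ (by norm_num) (by norm_num)]
      norm_num [enorm_mul, mul_comm]
    have hH := ENNReal.lintegral_mul_norm_pow_le (hη' x)
      ((hη' x).mul (hf.enorm.pow_const (2 : ℝ))) (p := 1 / 2) (q := 1 / 2) (by norm_num)
      (by norm_num) (by norm_num)
    rw [lintegral_sub_left_eq_self (fun t => ‖η t‖ₑ) x, h1, ENNReal.one_rpow, one_mul] at hH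
    refine (ENNReal.rpow_le_rpow (hle.trans hH) zero_le_two).trans_eq ?_
    rw [← ENNReal.rpow_mul]
    norm_num
  suffices h : eLpNorm (f ⋆[ContinuousLinearMap.mul ℝ ℝ] η) (.ofReal 2) volume ≤
      eLpNorm f (.ofReal 2) volume by rwa [ENNReal.ofReal_ofNat] at h
  refine eLpNorm_le_of_lintegral_rpow_le two_pos ?_
  refine (lintegral_mono key).trans ?_
  have hm : AEMeasurable (fun z : RN N × RN N => ‖η (z.1 - z.2)‖ₑ * ‖f z.2‖ₑ ^ (2 : ℝ))
      (prodVolume N) :=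
    (hη.enorm.comp_quasiMeasurePreserving (quasiMeasurePreserving_sub N)).mul
      (hf.enorm.pow_const _).comp_snd
  rw [← lintegral_prod _ hm, lintegral_sub_mul_snd hη.enorm (hf.enorm.pow_const _), h1, one_mul]
  exact lintegral_rpow_le_of_eLpNorm_le two_pos le_rfl

theorem lintegral_enorm_normed (φ : ContDiffBump (0 : RN N)) :
    ∫⁻ x, ‖φ.normed volume x‖ₑ = 1 := by
  have h := ofReal_integral_eq_lintegral_ofReal (φ.integrable_normed (μ := volume))
    (.of_forall φ.nonneg_normed)
  rw [φ.integral_normed, ENNReal.ofReal_one] at h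
  rw [h]
  refine lintegral_congr fun x => ?_
  rw [Real.enorm_eq_ofReal_abs, abs_of_nonneg (φ.nonneg_normed x)]

theorem contDiff_convolution_test {u η : RN N → ℝ} (hu : MemLp u 2 volume) (hη : ContDiff ℝ ∞ η)
    (hc : HasCompactSupport η) : ContDiff ℝ 1 (u ⋆[ContinuousLinearMap.mul ℝ ℝ] η) :=
  hc.contDiff_convolution_right (n := 1) _ (hu.locallyIntegrable one_le_two)
    (hη.of_le (by exact_mod_cast le_top))

/-- Mollification commutes with the weak gradient. -/
theorem fderiv_convolution_test {u η : RN N → ℝ} {g : RN N → RN N} (hu : MemLp u 2 volume)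
    (hg : IsWeakGradient u g) (hη : ContDiff ℝ ∞ η) (hc : HasCompactSupport η) (x : RN N)
    (i : Fin N) :
    fderiv ℝ (u ⋆[ContinuousLinearMap.mul ℝ ℝ] η) x (EuclideanSpace.single i 1) =
      ((fun y => g y i) ⋆[ContinuousLinearMap.mul ℝ ℝ] η) x := by
  have hl := hu.locallyIntegrable one_le_two
  have hη1 : ContDiff ℝ 1 η := hη.of_le (by exact_mod_cast le_top)
  rw [(hc.hasFDerivAt_convolution_right (ContinuousLinearMap.mul ℝ ℝ) hl hη1 x).fderiv,
    convolution_precompR_apply _ hl (hc.fderiv ℝ) (hη1.continuous_fderiv one_ne_zero)]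
  have hd : ∀ t, fderiv ℝ (fun t => η (x - t)) t = -fderiv ℝ η (x - t) := by
    intro t
    have h := ((hη1.differentiable one_ne_zero (x - t)).hasFDerivAt.comp t
      ((hasFDerivAt_id t).const_sub x)).fderiv
    refine h.trans ?_
    ext v
    simp
  -- The test function is t ↦ η(x - t): the sign from differentiating it cancels the sign in the
  -- weak gradient.
  have h := hg (fun t => η (x - t)) (hη.comp (contDiff_const.sub contDiff_id))
    (hc.comp_homeomorph (Homeomorph.subLeft x)) i
  simp only [hd, neg_apply, mul_neg, integral_neg, neg_inj] at h
  simpa only [convolution_def, ContinuousLinearMap.mul_apply'] using h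

theorem enorm_dual_le_sum (A : RN N →L[ℝ] ℝ) :
    ‖A‖ₑ ≤ ∑ i, ‖A (EuclideanSpace.single i 1)‖ₑ := by
  have h : ‖A‖ ≤ ∑ i, ‖A (EuclideanSpace.single i 1)‖ := by
    refine A.opNorm_le_bound (Finset.sum_nonneg fun _ _ => norm_nonneg _) fun v => ?_
    have hv : v = ∑ i, v i • EuclideanSpace.single i (1 : ℝ) := by
      simpa using ((EuclideanSpace.basisFun (Fin N) ℝ).sum_repr v).symm
    calc ‖A v‖ = ‖∑ i, v i * A (EuclideanSpace.single i 1)‖ := by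
          conv_lhs => rw [hv]
          simp
      _ ≤ ∑ i, ‖v i‖ * ‖A (EuclideanSpace.single i 1)‖ := by
          refine (norm_sum_le _ _).trans_eq ?_
          simp
      _ ≤ ∑ i, ‖v‖ * ‖A (EuclideanSpace.single i 1)‖ := by
          gcongr with i
          exact PiLp.norm_apply_le v i
      _ = (∑ i, ‖A (EuclideanSpace.single i 1)‖) * ‖v‖ := by
          rw [Finset.sum_mul]
          exact Finset.sum_congr rfl fun _ _ => mul_comm _ _
  rw [← ofReal_norm]
  refine (ENNReal.ofReal_le_ofReal h).trans_eq ?_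
  rw [ENNReal.ofReal_sum_of_nonneg fun _ _ => norm_nonneg _]
  exact Finset.sum_congr rfl fun i _ => ofReal_norm _

/-- Each coordinate of the gradient is a mollified coordinate of g, of L² norm at most that of g;
summing the coordinates costs the factor N. -/
theorem eLpNorm_fderiv_convolution_le {u : RN N → ℝ} {g : RN N → RN N} (hu : MemLp u 2 volume)
    (hg2 : MemLp g 2 volume) (hg : IsWeakGradient u g) (φ : ContDiffBump (0 : RN N)) :
    eLpNorm (fderiv ℝ (u ⋆[ContinuousLinearMap.mul ℝ ℝ] φ.normed volume)) 2 volume ≤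
      N * eLpNorm g 2 volume := by
  have hη : ContDiff ℝ ∞ (φ.normed volume) := φ.contDiff_normed
  have hgi : ∀ i, AEStronglyMeasurable (fun y => g y i) volume := fun i =>
    (EuclideanSpace.proj (𝕜 := ℝ) i : RN N →L[ℝ] ℝ).continuous.comp_aestronglyMeasurable hg2.1
  have hcont : ∀ i, Continuous ((fun y => g y i) ⋆[ContinuousLinearMap.mul ℝ ℝ] φ.normed volume) :=
    fun i => φ.hasCompactSupport_normed.continuous_convolution_right _
      (((EuclideanSpace.proj (𝕜 := ℝ) i : RN N →L[ℝ] ℝ).comp_memLp' hg2).locallyIntegrable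
        one_le_two) hη.continuous
  calc eLpNorm (fderiv ℝ (u ⋆[ContinuousLinearMap.mul ℝ ℝ] φ.normed volume)) 2 volume
      ≤ eLpNorm (∑ i, fun x =>
          ‖((fun y => g y i) ⋆[ContinuousLinearMap.mul ℝ ℝ] φ.normed volume) x‖ₑ) 2 volume := by
        refine eLpNorm_mono_enorm fun x => ?_
        rw [Finset.sum_apply, enorm_eq_self]
        refine (enorm_dual_le_sum _).trans_eq (Finset.sum_congr rfl fun i _ => ?_)
        rw [fderiv_convolution_test hu hg hη φ.hasCompactSupport_normed]
    _ ≤ ∑ i : Fin N, eLpNorm (fun x =>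
          ‖((fun y => g y i) ⋆[ContinuousLinearMap.mul ℝ ℝ] φ.normed volume) x‖ₑ) 2 volume :=
        eLpNorm_sum_le (fun i _ => (hcont i).enorm.aestronglyMeasurable) one_le_two
    _ ≤ ∑ i : Fin N, eLpNorm g 2 volume := by
        gcongr with i
        rw [eLpNorm_enorm]
        refine (eLpNorm_convolution_le (hgi i) hη.continuous.aestronglyMeasurable
          (lintegral_enorm_normed φ)).trans (eLpNorm_mono fun x => PiLp.norm_apply_le (g x) i)
    _ = N * eLpNorm g 2 volume := by simp

/-- Dilated cutoff functions: smooth, compactly supported, with uniformly bounded derivatives, and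
eventually equal to `1` at every point. -/
theorem exists_cutoff (N : ℕ) : ∃ (D : NNReal) (χ : ℕ → RN N → ℝ),
    (∀ n, ContDiff ℝ 1 (χ n)) ∧ (∀ n, HasCompactSupport (χ n)) ∧ (∀ n x, ‖χ n x‖ₑ ≤ 1) ∧
      (∀ n x, ‖fderiv ℝ (χ n) x‖ₑ ≤ D) ∧ ∀ x, ∀ᶠ n in atTop, χ n x = 1 := by
  let χ : ContDiffBump (0 : RN N) := ⟨1, 2, one_pos, one_lt_two⟩
  have hχ : ContDiff ℝ 1 χ := χ.contDiff
  obtain ⟨D, hD⟩ := (hχ.continuous_fderiv one_ne_zero).bounded_above_of_compact_support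
    (χ.hasCompactSupport.fderiv ℝ)
  have hD0 : 0 ≤ D := (norm_nonneg _).trans (hD 0)
  have hc : ∀ n : ℕ, ((n : ℝ) + 1)⁻¹ ≠ 0 := fun n => inv_ne_zero (by positivity)
  refine ⟨D.toNNReal, fun n x => χ (((n : ℝ) + 1)⁻¹ • x), fun n => ?_, fun n => ?_, fun n x => ?_,
    fun n x => ?_, fun x => ?_⟩
  · exact hχ.comp (contDiff_const_smul _)
  · exact χ.hasCompactSupport.comp_homeomorph (Homeomorph.smulOfNeZero _ (hc n))
  · rw [Real.enorm_eq_ofReal_abs, abs_of_nonneg χ.nonneg]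
    simpa using ENNReal.ofReal_le_ofReal (χ.le_one (x := ((n : ℝ) + 1)⁻¹ • x))
  · have h : fderiv ℝ (fun x => χ (((n : ℝ) + 1)⁻¹ • x)) x =
        ((n : ℝ) + 1)⁻¹ • fderiv ℝ χ (((n : ℝ) + 1)⁻¹ • x) := by
      refine ((hχ.differentiable one_ne_zero _).hasFDerivAt.comp x
        ((hasFDerivAt_id x).const_smul ((n : ℝ) + 1)⁻¹)).fderiv.trans ?_
      ext v
      simp
    rw [h, ← ofReal_norm]
    refine ENNReal.ofReal_le_ofReal ?_
    rw [norm_smul, Real.norm_of_nonneg (by positivity)]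
    refine (mul_le_of_le_one_left (norm_nonneg _) (inv_le_one_of_one_le₀ ?_)).trans (hD _)
    linarith [n.cast_nonneg (α := ℝ)]
  · obtain ⟨m, hm⟩ := exists_nat_ge ‖x‖
    filter_upwards [eventually_ge_atTop m] with n hn
    refine χ.one_of_mem_closedBall ?_
    rw [mem_closedBall_zero_iff, norm_smul, Real.norm_of_nonneg (by positivity),
      inv_mul_le_iff₀ (by positivity)]
    have : (m : ℝ) ≤ n := by exact_mod_cast hn
    change ‖x‖ ≤ ((n : ℝ) + 1) * 1
    linarith

theorem eLpNorm_fderiv_mul_le {w χ : RN N → ℝ} {D : NNReal} (hw : ContDiff ℝ 1 w)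
    (hχ : ContDiff ℝ 1 χ) (h1 : ∀ x, ‖χ x‖ₑ ≤ 1) (hD : ∀ x, ‖fderiv ℝ χ x‖ₑ ≤ D) :
    eLpNorm (fderiv ℝ fun x => χ x * w x) 2 volume ≤
      eLpNorm (fderiv ℝ w) 2 volume + D * eLpNorm w 2 volume := by
  have h : (fderiv ℝ fun x => χ x * w x) =
      (fun x => χ x • fderiv ℝ w x) + fun x => w x • fderiv ℝ χ x := by
    funext x
    exact ((hχ.differentiable one_ne_zero x).hasFDerivAt.mul
      (hw.differentiable one_ne_zero x).hasFDerivAt).fderiv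
  have hwd := hw.continuous_fderiv one_ne_zero
  have hχd := hχ.continuous_fderiv one_ne_zero
  rw [h]
  refine (eLpNorm_add_le (hχ.continuous.smul hwd).aestronglyMeasurable
    (hw.continuous.smul hχd).aestronglyMeasurable one_le_two).trans (add_le_add ?_ ?_)
  · refine eLpNorm_mono_enorm fun x => ?_
    change ‖χ x • fderiv ℝ w x‖ₑ ≤ _
    rw [enorm_smul]
    exact mul_le_of_le_one_left' (h1 x)
  · refine eLpNorm_le_nnreal_smul_eLpNorm_of_ae_le_mul (.of_forall fun x => ?_) 2
    change ‖w x • fderiv ℝ χ x‖₊ ≤ _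
    rw [nnnorm_smul, mul_comm]
    gcongr
    exact_mod_cast hD x

/-- Mollify, then cut off. Uniform bounds and almost-everywhere convergence are enough for Fatou's
lemma, so convergence in H¹ is not needed. -/
theorem exists_contDiff_approx (N : ℕ) : ∃ D : NNReal, ∀ (u : RN N → ℝ) (g : RN N → RN N),
    MemLp u 2 volume → MemLp g 2 volume → IsWeakGradient u g → ∃ v : ℕ → RN N → ℝ,
      (∀ n, ContDiff ℝ 1 (v n)) ∧ (∀ n, HasCompactSupport (v n)) ∧
      (∀ n, eLpNorm (v n) 2 volume ≤ D * (eLpNorm u 2 volume + eLpNorm g 2 volume)) ∧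
      (∀ n, eLpNorm (fderiv ℝ (v n)) 2 volume ≤
        D * (eLpNorm u 2 volume + eLpNorm g 2 volume)) ∧
      ∀ᵐ x, Tendsto (fun n => v n x) atTop (𝓝 (u x)) := by
  obtain ⟨D, χ, hχ, hχc, hχ1, hχD, hχt⟩ := exists_cutoff N
  -- N comes from the mollified gradient, D from the gradient of the cutoff, and 1 from the L²
  -- bound.
  refine ⟨1 + D + N, fun u g hu hg2 hg => ?_⟩
  let φ : ℕ → ContDiffBump (0 : RN N) := fun n =>
    ⟨((n : ℝ) + 1)⁻¹, 2 * ((n : ℝ) + 1)⁻¹, by positivity, by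
      have : 0 < ((n : ℝ) + 1)⁻¹ := by positivity
      linarith⟩
  let w : ℕ → RN N → ℝ := fun n => u ⋆[ContinuousLinearMap.mul ℝ ℝ] (φ n).normed volume
  have hη : ∀ n, ContDiff ℝ ∞ ((φ n).normed volume) := fun n => (φ n).contDiff_normed
  have hw : ∀ n, ContDiff ℝ 1 (w n) := fun n =>
    contDiff_convolution_test hu (hη n) (φ n).hasCompactSupport_normed
  have hwu : ∀ n, eLpNorm (w n) 2 volume ≤ eLpNorm u 2 volume := fun n =>
    eLpNorm_convolution_le hu.1 (hη n).continuous.aestronglyMeasurable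
      (lintegral_enorm_normed (φ n))
  refine ⟨fun n x => χ n x * w n x, fun n => (hχ n).mul (hw n), fun n => (hχc n).mul_right,
    fun n => ?_, fun n => ?_, ?_⟩
  · calc eLpNorm (fun x => χ n x * w n x) 2 volume ≤ eLpNorm (w n) 2 volume := by
          refine eLpNorm_mono_enorm fun x => ?_
          rw [enorm_mul]
          exact mul_le_of_le_one_left' (hχ1 n x)
      _ ≤ 1 * (eLpNorm u 2 volume + eLpNorm g 2 volume) := by
          rw [one_mul]
          exact (hwu n).trans le_self_add
      _ ≤ _ := by
          gcongr
          push_cast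
          rw [add_assoc]
          exact le_self_add
  · calc eLpNorm (fderiv ℝ fun x => χ n x * w n x) 2 volume
        ≤ eLpNorm (fderiv ℝ (w n)) 2 volume + D * eLpNorm (w n) 2 volume :=
          eLpNorm_fderiv_mul_le (hw n) (hχ n) (hχ1 n) (hχD n)
      _ ≤ N * eLpNorm g 2 volume + D * eLpNorm u 2 volume := by
          gcongr
          · exact eLpNorm_fderiv_convolution_le hu hg2 hg (φ n)
          · exact hwu n
      _ ≤ N * (eLpNorm u 2 volume + eLpNorm g 2 volume) +
            (1 + D) * (eLpNorm u 2 volume + eLpNorm g 2 volume) := by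
          gcongr
          · exact le_add_self
          · exact le_add_self
          · exact le_self_add
      _ = _ := by
          push_cast
          ring
  · have hlim : Tendsto (fun n => (φ n).rOut) atTop (𝓝 0) := by
      have := (tendsto_one_div_add_atTop_nhds_zero_nat (𝕜 := ℝ)).const_mul 2
      simpa only [one_div, mul_zero] using this
    -- Almost-everywhere convergence needs a bounded ratio of outer to inner radius; here it is
    -- always 2.
    filter_upwards [ContDiffBump.ae_convolution_tendsto_right_of_locallyIntegrable hlim (K := 2)
      (.of_forall fun n => le_rfl) (hu.locallyIntegrable one_le_two)] with x hx
    refine hx.congr' ?_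
    filter_upwards [hχt x] with n hn
    rw [hn, one_mul, convolution_eq_swap]
    exact integral_congr_ae (.of_forall fun t => by simp [mul_comm])

/-- The Sobolev inequality on `H¹(ℝ^N)`. -/
theorem exists_eLpNorm_le_of_isWeakGradient {N : ℕ} (hN : 1 ≤ N) {r : ℝ} (hr : 2 ≤ r)
    (hNr : 1 / 2 - 1 / (N : ℝ) ≤ 1 / r) : ∃ C : NNReal, ∀ (u : RN N → ℝ) (g : RN N → RN N),
    MemLp u 2 volume → MemLp g 2 volume → IsWeakGradient u g →
      eLpNorm u (.ofReal r) volume ≤ C * (eLpNorm u 2 volume + eLpNorm g 2 volume) := by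
  obtain ⟨C, hC⟩ := exists_eLpNorm_le_of_contDiff hN hr hNr
  obtain ⟨D, hD⟩ := exists_contDiff_approx N
  refine ⟨C * D, fun u g hu hg2 hg => ?_⟩
  obtain ⟨v, hv, hvc, hv2, hvd, hvt⟩ := hD u g hu hg2 hg
  -- Fatou's lemma: the L^r norm is lower semicontinuous under almost-everywhere convergence.
  refine (Lp.eLpNorm_lim_le_liminf_eLpNorm
    (fun n => (hv n).continuous.aestronglyMeasurable) u hvt).trans ?_
  refine liminf_le_of_frequently_le' (.of_forall fun n => ?_)
  refine (hC (v n) (hv n) (hvc n) _ (hv2 n) (hvd n)).trans_eq ?_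
  push_cast
  ring

end Mollification

/-! ### The Sobolev embedding as a continuous linear map. -/

section Embedding

variable {N : ℕ} {r : ℝ}

theorem H1.coeFn_fst_add (u v : H1 N) :
    ((u + v).1.fst : RN N → ℝ) =ᵐ[volume] (u.1.fst : RN N → ℝ) + (v.1.fst : RN N → ℝ) := by
  have h : (u + v).1.fst = u.1.fst + v.1.fst := by rw [Submodule.coe_add, WithLp.add_fst]
  rw [h]
  exact Lp.coeFn_add _ _

theorem H1.coeFn_fst_smul (c : ℝ) (u : H1 N) :
    ((c • u).1.fst : RN N → ℝ) =ᵐ[volume] c • (u.1.fst : RN N → ℝ) := by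
  have h : (c • u).1.fst = c • u.1.fst := by rw [Submodule.coe_smul, WithLp.smul_fst]
  rw [h]
  exact Lp.coeFn_smul _ _

theorem memLp_of_H1 (hN : 1 ≤ N) (hr : 2 ≤ r) (hNr : 1 / 2 - 1 / (N : ℝ) ≤ 1 / r) (u : H1 N) :
    MemLp (u.1.fst : RN N → ℝ) (.ofReal r) volume := by
  obtain ⟨C, hC⟩ := exists_eLpNorm_le_of_isWeakGradient hN hr hNr
  refine ⟨Lp.aestronglyMeasurable _, (hC _ _ (Lp.memLp u.1.fst) (Lp.memLp u.1.snd) u.2).trans_lt ?_⟩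
  have h1 := (Lp.memLp u.1.fst).2
  have h2 := (Lp.memLp u.1.snd).2
  finiteness

/-- The Sobolev embedding of `H¹(ℝ^N)` into `L^r(ℝ^N)`. -/
theorem exists_sobolev_embedding (hN : 1 ≤ N) (hr : 2 ≤ r) (hNr : 1 / 2 - 1 / (N : ℝ) ≤ 1 / r)
    [Fact (1 ≤ ENNReal.ofReal r)] :
    ∃ ι : H1 N →L[ℝ] Lp ℝ (.ofReal r) (volume : Measure (RN N)),
      ∀ u, ι u =ᵐ[volume] (u.1.fst : RN N → ℝ) := by
  obtain ⟨C, hC⟩ := exists_eLpNorm_le_of_isWeakGradient hN hr hNr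
  let ι : H1 N →ₗ[ℝ] Lp ℝ (.ofReal r) (volume : Measure (RN N)) :=
    { toFun := fun u => (memLp_of_H1 hN hr hNr u).toLp
      map_add' := fun u v => by
        rw [← MemLp.toLp_add]
        exact MemLp.toLp_congr _ _ (H1.coeFn_fst_add u v)
      map_smul' := fun c u =>
        (MemLp.toLp_congr _ ((memLp_of_H1 hN hr hNr u).const_smul c)
          (H1.coeFn_fst_smul c u)).trans (MemLp.toLp_const_smul c _) }
  refine ⟨ι.mkContinuous (C * 2) fun u => ?_, fun u => MemLp.coeFn_toLp (memLp_of_H1 hN hr hNr u)⟩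
  have h := hC _ _ (Lp.memLp u.1.fst) (Lp.memLp u.1.snd) u.2
  have h1 := (Lp.memLp u.1.fst).2
  have h2 := (Lp.memLp u.1.snd).2
  calc ‖ι u‖ = (eLpNorm (u.1.fst : RN N → ℝ) (.ofReal r) volume).toReal :=
        Lp.norm_toLp _ (memLp_of_H1 hN hr hNr u)
    _ ≤ (C * (eLpNorm u.1.fst 2 volume + eLpNorm u.1.snd 2 volume)).toReal :=
        ENNReal.toReal_mono (by finiteness) h
    _ = C * (‖u.1.fst‖ + ‖u.1.snd‖) := by
        rw [ENNReal.toReal_mul, ENNReal.toReal_add (by finiteness) (by finiteness), Lp.norm_def,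
          Lp.norm_def, ENNReal.coe_toReal]
    _ ≤ C * (‖u‖ + ‖u‖) := by
        gcongr
        · exact WithLp.norm_fst_le _ u.1
        · exact WithLp.norm_snd_le _ u.1
    _ = C * 2 * ‖u‖ := by ring

end Embedding

/-! ### Existence of the convolution and smoothness of the functional. -/

section Functional

variable {N : ℕ}

/-- If the convolution form of `W` is bounded on `L^s`, then `W ∗ f` exists almost everywhere for
`f ∈ L^s`. -/
theorem ConvolutionBound.ae_convolutionExistsAt {W : RN N → ℝ} {s C : ℝ≥0∞}
    (h : ConvolutionBound W s C) (hC : C ≠ ⊤) (hW : AEStronglyMeasurable W volume)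
    {f : RN N → ℝ} (hf : MemLp f s volume) :
    ∀ᵐ x, ConvolutionExistsAt W f x (ContinuousLinearMap.mul ℝ ℝ) volume := by
  have key : ∀ n : ℕ, ∀ᵐ x : RN N, x ∈ Metric.closedBall (0 : RN N) n →
      ConvolutionExistsAt W f x (ContinuousLinearMap.mul ℝ ℝ) volume := by
    intro n
    -- Testing against the indicator of a ball makes the double integrand integrable; Fubini then
    -- gives integrable slices at almost every x of the ball.
    have hg : MemLp ((Metric.closedBall (0 : RN N) n).indicator fun _ => (1 : ℝ)) s volume :=
      memLp_indicator_const s Metric.isClosed_closedBall.measurableSet 1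
        (Or.inr measure_closedBall_lt_top.ne)
    filter_upwards [(h.integrable hC hW hf hg).prod_right_ae] with x hx hxn
    simpa [Set.indicator_of_mem hxn, ConvolutionExistsAt] using hx
  filter_upwards [ae_all_iff.2 key] with x hx
  obtain ⟨n, hn⟩ := exists_nat_ge ‖x‖
  exact hx n (mem_closedBall_zero_iff.2 hn)

theorem integrable_convolution_mul {W f g : RN N → ℝ}
    (h : Integrable (fun z : RN N × RN N => W z.2 * (f (z.1 - z.2) * g z.1)) (prodVolume N)) :
    Integrable (fun x => (W ⋆[ContinuousLinearMap.mul ℝ ℝ] f) x * g x) volume := by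
  refine h.integral_prod_left.congr (.of_forall fun x => ?_)
  simp only [convolution_def, ContinuousLinearMap.mul_apply', ← integral_mul_const, mul_assoc]

theorem integral_convolution_mul {W f g : RN N → ℝ}
    (h : Integrable (fun z : RN N × RN N => W z.2 * (f (z.1 - z.2) * g z.1)) (prodVolume N)) :
    ∫ x, (W ⋆[ContinuousLinearMap.mul ℝ ℝ] f) x * g x =
      ∫ z, W z.2 * (f (z.1 - z.2) * g z.1) ∂(prodVolume N) := by
  rw [integral_prod _ h]
  simp only [convolution_def, ContinuousLinearMap.mul_apply', ← integral_mul_const, mul_assoc]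

variable {p q r s : ℝ}

theorem memLp_absPow (hN : 1 ≤ N) (hp : 2 ≤ p) (hs : 0 < s) (hrs : p * s = r) (hr : 2 ≤ r)
    (hNr : 1 / 2 - 1 / (N : ℝ) ≤ 1 / r) (u : H1 N) : MemLp (absPow p u) (.ofReal s) volume :=
  memLp_abs_rpow hp hs (by linarith) hrs (memLp_of_H1 hN hr hNr u)

/-- If the convolution form of `W` is bounded on `L^s`, then `u ↦ ∫ (W ∗ |u|^p) |u|^p` is
continuously differentiable on `H¹`, provided that `H¹` embeds into `L^(ps)`. -/
theorem ConvolutionBound.contDiff {W : RN N → ℝ} {C : ℝ≥0∞}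
    (h : ConvolutionBound W (.ofReal s) C) (hC : C ≠ ⊤) (hW : AEStronglyMeasurable W volume)
    (hN : 1 ≤ N) (hp : 2 ≤ p) (hs : 1 ≤ s) (hrs : p * s = r)
    (hNr : 1 / 2 - 1 / (N : ℝ) ≤ 1 / r) :
    ContDiff ℝ 1 fun u : H1 N =>
      ∫ z, W z.2 * (absPow p u (z.1 - z.2) * absPow p u z.1) ∂(prodVolume N) := by
  have hr : 2 ≤ r := by rw [← hrs]; nlinarith
  have hr0 : 0 < r := by linarith
  have : Fact (1 ≤ ENNReal.ofReal s) := ⟨by simpa using ENNReal.ofReal_le_ofReal hs⟩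
  have : Fact (1 ≤ ENNReal.ofReal r) :=
    ⟨by simpa using ENNReal.ofReal_le_ofReal (one_le_two.trans hr)⟩
  obtain ⟨ι, hι⟩ := exists_sobolev_embedding (N := N) hN hr hNr
  obtain ⟨B, hB⟩ := h.exists_bilinear hC hW
  have hΦ : ContDiff ℝ 1 fun u : H1 N =>
      powLp volume hp (zero_lt_one.trans_le hs) hr0 hrs (ι u) :=
    (contDiff_powLp hp hs hr0 hrs).comp ι.contDiff
  -- The functional is B(Φ(u), Φ(u)) with Φ of class C¹.
  have hBΦ := (B.contDiff.comp hΦ).clm_apply hΦ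
  convert hBΦ using 1
  funext u
  have hu : powLp volume hp (zero_lt_one.trans_le hs) hr0 hrs (ι u) =ᵐ[volume] absPow p u := by
    filter_upwards [coeFn_powLp hp (zero_lt_one.trans_le hs) hr0 hrs (ι u), hι u] with x h1 h2
    rw [h1, h2, absPow]
  rw [Function.comp_apply, hB]
  exact (integral_convolution_mul_congr hu hu).symm

end Functional

end Choquard

/-! ### Splitting the relaxed potential. -/

open Choquard in
theorem lemma2p2 (N : ℕ) (hN : 1 ≤ N) (p q : ℝ) (hp : 2 ≤ p) (hq : 1 ≤ q)
    (V : Choquard.RN N → ℝ) (hV_even : Function.Even V) (hV_meas : AEMeasurable V volume)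
    (hV_pos : MemLp (fun x => max (V x) 0) (ENNReal.ofReal q) volume)
    (hpq : 1 / 2 - 1 / (N : ℝ) ≤ 1 / p * (1 - 1 / (2 * q)))
    (lam : ℝ) (hlam : 0 ≤ lam) :
    (∀ u : Choquard.H1 N,
      (∀ᵐ x, ConvolutionExistsAt (Choquard.relaxedPotential V lam) (Choquard.absPow p u) x
        (ContinuousLinearMap.mul ℝ ℝ) volume) ∧
      Integrable (fun x => Choquard.relaxedConv p V lam u x * Choquard.absPow p u x) volume) ∧
    ContDiff ℝ 1 (Choquard.relaxedFunctional p V lam : Choquard.H1 N → ℝ) := by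
  have hp0 : 0 < p := by linarith
  have hq2 : 1 / (2 * q) ≤ 1 / 2 := one_div_le_one_div_of_le two_pos (by linarith)
  have hq0 : 0 < 1 / (2 * q) := by positivity
  -- The Young exponent, for which 1/q + 2/s = 2.
  obtain ⟨s, hs⟩ : ∃ s : ℝ, 1 / s = 1 - 1 / (2 * q) := ⟨1 / (1 - 1 / (2 * q)), one_div_one_div _⟩
  have hs0 : 0 < s := one_div_pos.1 (by rw [hs]; linarith)
  have hs1 : 1 ≤ s := by
    rw [← one_div_le_one_div hs0 one_pos, hs]
    linarith
  have hr : 2 ≤ p * s := by nlinarith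
  have hNr : 1 / 2 - 1 / (N : ℝ) ≤ 1 / (p * s) := by
    rwa [← hs, one_div_mul_one_div_rev, mul_comm s p] at hpq
  -- The L¹ theory is the case s = 1; its Sobolev exponent p is at most ps, so it is admissible too.
  have hNp : 1 / 2 - 1 / (N : ℝ) ≤ 1 / (p * 1) :=
    hNr.trans (one_div_le_one_div_of_le (by linarith) (by gcongr))
  let W₁ : RN N → ℝ := fun x => max (V x) 0
  -- The difference V_lam - V⁺ is bounded by lam, although V itself may be unbounded below.
  let W₂ : RN N → ℝ := fun x => max (V x) (-lam) - max (V x) 0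
  have hW₁ : AEStronglyMeasurable W₁ volume := hV_pos.1
  have hW₂ : AEStronglyMeasurable W₂ volume :=
    ((hV_meas.max aemeasurable_const).sub (hV_meas.max aemeasurable_const)).aestronglyMeasurable
  have hW₂_le : ∀ x, |W₂ x| ≤ lam := fun x => by
    refine (abs_max_sub_max_le_max (V x) (-lam) (V x) 0).trans ?_
    simp [abs_of_nonneg hlam, hlam]
  have hB₁ : ConvolutionBound W₁ (.ofReal s) _ := convolutionBound_of_memLp hq hs hs0 hV_pos
  have hC₁ : eLpNorm W₁ (.ofReal q) volume ≠ ⊤ := hV_pos.2.ne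
  have hB₂ : ConvolutionBound W₂ (.ofReal 1) (.ofReal lam) := by
    rw [ENNReal.ofReal_one]
    exact convolutionBound_of_bounded hW₂_le
  have hsplit : relaxedPotential V lam = W₁ + W₂ := by
    funext x
    simp [relaxedPotential, W₁, W₂]
  have hu₁ : ∀ u : H1 N, MemLp (absPow p u) (.ofReal s) volume :=
    memLp_absPow hN hp hs0 rfl hr hNr
  have hu₂ : ∀ u : H1 N, MemLp (absPow p u) (.ofReal 1) volume :=
    memLp_absPow hN hp one_pos rfl (by linarith) hNp
  have hI₁ := fun u => hB₁.integrable hC₁ hW₁ (hu₁ u) (hu₁ u)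
  have hI₂ := fun u => hB₂.integrable ENNReal.ofReal_ne_top hW₂ (hu₂ u) (hu₂ u)
  have hI : ∀ u : H1 N, Integrable (fun z : RN N × RN N => relaxedPotential V lam z.2 *
      (absPow p u (z.1 - z.2) * absPow p u z.1)) (prodVolume N) := fun u => by
    refine ((hI₁ u).add (hI₂ u)).congr (.of_forall fun z => ?_)
    rw [hsplit]
    simp only [Pi.add_apply]
    ring
  refine ⟨fun u => ⟨?_, integrable_convolution_mul (hI u)⟩, ?_⟩
  · filter_upwards [hB₁.ae_convolutionExistsAt hC₁ hW₁ (hu₁ u),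
      hB₂.ae_convolutionExistsAt ENNReal.ofReal_ne_top hW₂ (hu₂ u)] with x h1 h2
    rw [hsplit]
    refine (h1.integrable.add h2.integrable).congr (.of_forall fun t => ?_)
    simp
  · convert (hB₁.contDiff hC₁ hW₁ hN hp hs1 rfl hNr).add
      (hB₂.contDiff ENNReal.ofReal_ne_top hW₂ hN hp le_rfl rfl hNp) using 1
    funext u
    rw [relaxedFunctional]
    refine (integral_convolution_mul (hI u)).trans ?_
    rw [← integral_add (hI₁ u) (hI₂ u), hsplit]
    refine integral_congr_ae (.of_forall fun z => ?_)
    simp only [Pi.add_apply]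
    ring
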